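/- Let $n,m\ge 2$ be integers and $s>0$. Let $L_n$ be the path graph on the vertices $1,\dots,n$, with edges $\{k,k+1\}$ for $1\le k\le n-1$, each of weight $1$. The symmetric beta-binomial splitting process $\mathrm{BB}(L_n,s,m)$ is the continuous-time Markov process on $$\Omega=\Big\{\xi\in\mathbb{N}_0^{\{1,\dots,n\}}:\ \sum_{k=1}^n\xi(k)=m\Big\}$$ with infinitesimal generator $$\mathcal{L}f(\xi)=\frac1{n-1}\sum_{k=1}^{n-1}\big(\mathbb{E}[f(\xi'_k)]-f(\xi)\big),$$ where $\xi'_k$ agrees with $\xi$ off $\{k,k+1\}$ and $\xi'_k(k)=X$, $\xi'_k(k+1)=\xi(k)+\xi(k+1)-X$ with $X\sim\mathrm{BetaBin}(\xi(k)+\xi(k+1),s,s)$, that is, $$\mathbb{P}(X=x)=\binom{r}{x}\frac{B(x+s,r-x+s)}{B(s,s)}\quad(0\le x\le r),\qquad r=\xi(k)+\xi(k+1),$$ where $B$ is the beta function. Its equilibrium distribution $\pi$ is given by $\pi(\xi)\propto\prod_{k=1}^n\Gamma(s+\xi(k))/\xi(k)!$. For $\varepsilon\in(0,1)$ let $$t_{\mathrm{mix}}^{\mathrm{BB}(L_n,s,m)}(\varepsilon)=\inf\Big\{t\ge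 0:\ \max_{\xi_0\in\Omega}\big\|\mathrm{Law}(\xi_t)-\pi\big\|_{\mathrm{TV}}\le\varepsilon\Big\},$$ where $\xi_t$ is the state at time $t$ of the process started from $\xi_0$ and $\|\mu-\nu\|_{\mathrm{TV}}=\sum_{\omega\in\Omega}\max\{\mu(\omega)-\nu(\omega),0\}$. Then for every $\varepsilon\in(0,1)$ there is a constant $C_\varepsilon>0$, depending only on $\varepsilon$, such that for all integers $n,m\ge 2$ and all real $s>0$, $$t_{\mathrm{mix}}^{\mathrm{BB}(L_n,s,m)}(\varepsilon)\ \ge\ \frac{n^3}{\pi^2}\left(\log n-\log\Big(1+\frac nm+\frac1s\Big)-C_\varepsilon\right),$$ where in the factor $n^3/\pi^2$ the symbol $\pi$ denotes the number $3.14159\ldots$ -/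

import Mathlib

noncomputable section

/-- The configurations of `m` particles on the vertex set `V`. -/
abbrev Config (V : Type*) [Fintype V] (m : ℕ) : Type _ := {ξ : V → ℕ // ∑ v, ξ v = m}

instance instFintypeConfig (V : Type*) [Fintype V] [DecidableEq V] (m : ℕ) :
    Fintype (Config V m) :=
  Fintype.subtype (Finset.piAntidiag Finset.univ m) (fun ξ => by simp [Finset.mem_piAntidiag])

/-- The probability that a BetaBin(`r`, `s`, `s`) random variable equals `x` (for `x ≤ r`). -/
def betaBin (r : ℕ) (s : ℝ) (x : ℕ) : ℝ :=
  (r.choose x : ℝ) * ProbabilityTheory.beta (x + s) (((r - x : ℕ) : ℝ) + s)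
    / ProbabilityTheory.beta s s

/-- The configuration obtained from `ξ` by redistributing the particles of `v` and `w`,
with `x` of them placed on `v` and the others on `w`. -/
def redistribute {V : Type*} [DecidableEq V] (ξ : V → ℕ) (v w : V) (x : ℕ) : V → ℕ :=
  fun u => if u = v then x else if u = w then ξ v + ξ w - x else ξ u

/-- The probability that the configuration becomes `ξ'` when it is `ξ` and the edge `{v, w}`
rings: `v` receives a BetaBin(`ξ v + ξ w`, `s`, `s`) number of the particles on the edge. -/
def ringProb {V : Type*} [Fintype V] [DecidableEq V] (s : ℝ) (v w : V) (ξ ξ' : V → ℕ) : ℝ :=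
  ∑ x ∈ Finset.range (ξ v + ξ w + 1),
    if redistribute ξ v w x = ξ' then betaBin (ξ v + ξ w) s x else 0

open Classical in
/-- The infinitesimal generator of BB(`G`, `s`, `m`), as a matrix `Q` on the configurations:
`𝓛 f = Q *ᵥ f`. The weight of the edge `e` is `r e`. The endpoints of an edge are
`e.inf < e.sup`; as BetaBin(·, `s`, `s`) is symmetric, their order plays no role. -/
def generatorBB {V : Type*} [Fintype V] [LinearOrder V] (G : SimpleGraph V) (r : Sym2 V → ℝ)
    (s : ℝ) (m : ℕ) : Matrix (Config V m) (Config V m) ℝ :=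
  fun ξ ξ' => ∑ e ∈ G.edgeFinset, r e / (∑ e' ∈ G.edgeFinset, r e') *
    (ringProb s e.inf e.sup ξ.1 ξ'.1 - if ξ = ξ' then 1 else 0)

/-- The weight `∏ v, Γ(s + ξ v) / (ξ v)!` of a configuration. -/
def weightBB {V : Type*} [Fintype V] (s : ℝ) (ξ : V → ℕ) : ℝ :=
  ∏ v, Real.Gamma (s + ξ v) / ((ξ v).factorial : ℝ)

/-- The equilibrium distribution of BB(`G`, `s`, `m`) for a connected graph `G` on `V`. -/
def equilibriumBB (V : Type*) [Fintype V] [DecidableEq V] (s : ℝ) (m : ℕ) : Config V m → ℝ :=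
  fun ξ => weightBB s ξ.1 / ∑ ξ' : Config V m, weightBB s ξ'.1

/-- The total variation distance of two probability mass functions on a finite set. -/
def tvDist {Ω : Type*} [Fintype Ω] (μ ν : Ω → ℝ) : ℝ := ∑ ω, max (μ ω - ν ω) 0

/-- The law at time `t` of the continuous-time Markov process with generator `Q`
that starts from `ω₀`: the row `ω₀` of `e ^ (t Q)`. -/
def lawAt {Ω : Type*} [Fintype Ω] [DecidableEq Ω] (Q : Matrix Ω Ω ℝ) (t : ℝ) (ω₀ : Ω) : Ω → ℝ :=
  fun ω => NormedSpace.exp (t • Q) ω₀ ω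

/-- The `ε`-total variation mixing time of the process with generator `Q` and equilibrium
distribution `π`: the infimum in `[0, ∞]` of the times `t ≥ 0` at which the law of the process
is within `ε` of `π` for every initial state. -/
def mixingTime {Ω : Type*} [Fintype Ω] [DecidableEq Ω] (Q : Matrix Ω Ω ℝ) (π : Ω → ℝ)
    (ε : ℝ) : EReal :=
  sInf ((fun t : ℝ => (t : EReal)) '' {t : ℝ | 0 ≤ t ∧ ∀ ω₀, tvDist (lawAt Q t ω₀) π ≤ ε})

/-- The `ε`-total variation mixing time of BB(`G`, `s`, `m`). -/
def mixingTimeBB {V : Type*} [Fintype V] [LinearOrder V] (G : SimpleGraph V) (r : Sym2 V → ℝ)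
    (s : ℝ) (m : ℕ) (ε : ℝ) : EReal :=
  mixingTime (generatorBB G r s m) (equilibriumBB V s m) ε

end

open Finset Matrix

/-! ### Moments of the beta-binomial distribution -/

/-! The argument is a second-moment (Wilson-type) bound for `F ξ = ∑ φ v * ξ v`, where `φ` is the
first nonconstant Neumann cosine of the path. A ring of an edge averages its two expected occupation
numbers, so `F` is an eigenfunction: its mean decays exactly like `exp (-lam * t)`, with `2 * lam`
of order `π² / n³`.

The initial state is random: `m` independent particles with law `(1 + φ) / n`. This makes the mean
of `F` equal to `m / 2`, while no vertex is much heavier than under the uniform law. An arbitrary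
start could have occupation second moments of order `m²`, which would spoil the variance bound.

A ring sends pair counts to nonnegative combinations of pair counts, and the profile `s + 1_{a = b}`
(the equilibrium two-point function up to scale) is fixed by this action. A bound by a multiple of
that profile therefore persists for all times (`MomentBound.vecMul_stepMatrix`). It controls the
noise injected at each step, so the variance of `F` stays of order `W = m² / n * (1 + n / m + 1 /
s)`; the equilibrium second moment of `F` is also of this order. By Chebyshev
(`le_sum_sub_of_moments`) the two laws are nearly singular while `m² * exp (-2 * lam * t)` is much
larger than `W`, which is the stated time.

Moments are computed for the discrete chain `P` and transferred to `exp (t • (P - 1))`, a Poisson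
mixture of the powers of `P`. The pieces meet in `le_of_tvDist_le`; `noise_le` and
`two_mul_lam_mul_le` make the constants explicit. -/

lemma beta_add_one_left {a b : ℝ} (ha : 0 < a) (hb : 0 < b) :
    ProbabilityTheory.beta (a + 1) b = a / (a + b) * ProbabilityTheory.beta a b := by
  have h1 : Real.Gamma (a + b) ≠ 0 := (Real.Gamma_pos_of_pos (by positivity)).ne'
  have h2 : a + b ≠ 0 := by positivity
  unfold ProbabilityTheory.beta
  rw [show a + 1 + b = a + b + 1 by ring, Real.Gamma_add_one ha.ne', Real.Gamma_add_one h2]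
  field_simp

lemma beta_add_one_right {a b : ℝ} (ha : 0 < a) (hb : 0 < b) :
    ProbabilityTheory.beta a (b + 1) = b / (a + b) * ProbabilityTheory.beta a b := by
  have h1 : Real.Gamma (a + b) ≠ 0 := (Real.Gamma_pos_of_pos (by positivity)).ne'
  have h2 : a + b ≠ 0 := by positivity
  unfold ProbabilityTheory.beta
  rw [show a + (b + 1) = a + b + 1 by ring, Real.Gamma_add_one hb.ne', Real.Gamma_add_one h2]
  field_simp

lemma beta_eq_add {a b : ℝ} (ha : 0 < a) (hb : 0 < b) :
    ProbabilityTheory.beta a b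
      = ProbabilityTheory.beta a (b + 1) + ProbabilityTheory.beta (a + 1) b := by
  rw [beta_add_one_left ha hb, beta_add_one_right ha hb]
  have h2 : a + b ≠ 0 := by positivity
  field_simp
  ring

/-- This is the beta integral with `(x + (1 - x)) ^ r = 1` inserted. The induction pairs Pascal's
rule with `beta_eq_add`. -/
lemma sum_choose_mul_beta (r : ℕ) {a b : ℝ} (ha : 0 < a) (hb : 0 < b) :
    ∑ p ∈ antidiagonal r, (r.choose p.1 : ℝ) * ProbabilityTheory.beta (p.1 + a) (p.2 + b)
      = ProbabilityTheory.beta a b := by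
  induction r generalizing a b with
  | zero => simp
  | succ r ih =>
    rw [Finset.sum_antidiagonal_choose_succ_mul
      (fun i j : ℕ => ProbabilityTheory.beta (i + a) (j + b))]
    have h1 := ih ha (b := b + 1) (by positivity)
    have h2 := ih (a := a + 1) (by positivity) hb
    rw [beta_eq_add ha hb, ← h1, ← h2]
    congr 1
    · refine sum_congr rfl fun p _ => ?_
      push_cast
      congr 2
      ring
    · refine sum_congr rfl fun p hp => ?_
      rw [HasAntidiagonal.mem_antidiagonal] at hp
      rw [← hp, Nat.choose_symm_add]
      push_cast
      congr 2
      ring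

/-- Absorption, `x * C(r+1, x) = (r+1) * C(r, x-1)`, trades a factor `x` for a shift of the first
beta parameter. Factorial moments thus reduce to `sum_choose_mul_beta`. -/
lemma sum_choose_mul_id_mul (r : ℕ) (h : ℕ → ℕ → ℝ) :
    ∑ p ∈ antidiagonal (r + 1), ((r + 1).choose p.1 : ℝ) * (p.1 * h p.1 p.2)
      = (r + 1) * ∑ p ∈ antidiagonal r, (r.choose p.1 : ℝ) * h (p.1 + 1) p.2 := by
  rw [Finset.Nat.sum_antidiagonal_succ, mul_sum]
  simp only [Nat.cast_zero, zero_mul, mul_zero, zero_add]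
  refine sum_congr rfl fun p _ => ?_
  have := Nat.add_one_mul_choose_eq r p.1
  have h' : ((r : ℝ) + 1) * (r.choose p.1 : ℝ)
      = ((r + 1).choose (p.1 + 1) : ℝ) * ((p.1 + 1 : ℕ) : ℝ) := by exact_mod_cast this
  rw [← mul_assoc, ← mul_assoc, h']

lemma sum_betaBin_mul (r : ℕ) (s : ℝ) (g : ℕ → ℝ) :
    ∑ x ∈ range (r + 1), betaBin r s x * g x
      = (∑ p ∈ antidiagonal r, (r.choose p.1 : ℝ)
          * (g p.1 * ProbabilityTheory.beta (p.1 + s) (p.2 + s))) / ProbabilityTheory.beta s s := by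
  rw [Finset.Nat.sum_antidiagonal_eq_sum_range_succ_mk, sum_div]
  refine sum_congr rfl fun x _ => ?_
  simp only [betaBin]
  ring

lemma betaBin_nonneg (r : ℕ) {s : ℝ} (hs : 0 < s) (x : ℕ) : 0 ≤ betaBin r s x := by
  unfold betaBin
  have h1 := ProbabilityTheory.beta_pos hs hs
  have h2 := ProbabilityTheory.beta_pos (show 0 < (x : ℝ) + s by positivity)
    (show 0 < ((r - x : ℕ) : ℝ) + s by positivity)
  positivity

lemma sum_betaBin (r : ℕ) {s : ℝ} (hs : 0 < s) :
    ∑ x ∈ range (r + 1), betaBin r s x = 1 := by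
  have h := sum_betaBin_mul r s (fun _ => 1)
  simp only [mul_one, one_mul] at h
  rw [h, sum_choose_mul_beta r hs hs, div_self (ProbabilityTheory.beta_pos hs hs).ne']

lemma sum_betaBin_mul_id (r : ℕ) {s : ℝ} (hs : 0 < s) :
    ∑ x ∈ range (r + 1), betaBin r s x * x = r / 2 := by
  rw [sum_betaBin_mul r s (fun x => (x : ℝ))]
  have hb := (ProbabilityTheory.beta_pos hs hs).ne'
  rcases r with _ | r
  · simp
  · rw [sum_choose_mul_id_mul r (fun i j => ProbabilityTheory.beta (i + s) (j + s))]
    have h := sum_choose_mul_beta r (a := s + 1) (by positivity) hs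
    rw [beta_add_one_left hs hs] at h
    have h' : ∑ p ∈ antidiagonal r, (r.choose p.1 : ℝ)
        * ProbabilityTheory.beta ((p.1 + 1 : ℕ) + s) (p.2 + s)
        = s / (s + s) * ProbabilityTheory.beta s s := by
      rw [← h]
      refine sum_congr rfl fun p _ => ?_
      push_cast
      congr 2
      ring
    rw [h']
    push_cast
    field_simp
    ring

lemma sum_betaBin_mul_id_mul_sub_one (r : ℕ) {s : ℝ} (hs : 0 < s) :
    ∑ x ∈ range (r + 1), betaBin r s x * (x * (x - 1))
      = (s + 1) / (2 * (2 * s + 1)) * (r * (r - 1)) := by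
  rw [sum_betaBin_mul r s (fun x => (x : ℝ) * (x - 1))]
  have hb := (ProbabilityTheory.beta_pos hs hs).ne'
  rcases r with _ | _ | r
  · simp
  · simp [Finset.Nat.sum_antidiagonal_succ]
  · have h1 := sum_choose_mul_id_mul (r + 1)
      (fun i j => ((i : ℝ) - 1) * ProbabilityTheory.beta (i + s) (j + s))
    have h2 := sum_choose_mul_id_mul r
      (fun i j => ProbabilityTheory.beta ((i + 1 : ℕ) + s) (j + s))
    have h := sum_choose_mul_beta r (a := s + 1 + 1) (by positivity) hs
    rw [beta_add_one_left (by positivity) hs, beta_add_one_left hs hs] at h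
    have h' : ∑ p ∈ antidiagonal r, (r.choose p.1 : ℝ)
        * ProbabilityTheory.beta ((p.1 + 1 + 1 : ℕ) + s) (p.2 + s)
        = (s + 1) / (s + 1 + s) * (s / (s + s) * ProbabilityTheory.beta s s) := by
      rw [← h]
      refine sum_congr rfl fun p _ => ?_
      push_cast
      congr 2
      ring
    simp only [mul_assoc] at h1 ⊢
    rw [h1]
    simp only [Nat.cast_add, Nat.cast_one, add_sub_cancel_right] at h1 h2 h' ⊢
    rw [h2, h']
    have : s + 1 + s ≠ 0 := by positivity
    field_simp
    ring

/-! ### The action of an edge ring on functions -/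

/-- The expectation of `f` after the edge `{v, w}` has rung in the configuration `ξ`. -/
noncomputable def ringOp {V : Type*} [DecidableEq V] (s : ℝ) (v w : V) (f : (V → ℕ) → ℝ)
    (ξ : V → ℕ) : ℝ :=
  ∑ x ∈ range (ξ v + ξ w + 1), betaBin (ξ v + ξ w) s x * f (redistribute ξ v w x)

section ringOp

variable {V : Type*} [DecidableEq V]

@[simp] lemma redistribute_left (ξ : V → ℕ) (v w : V) (x : ℕ) : redistribute ξ v w x v = x := by
  simp [redistribute]

@[simp] lemma redistribute_right (ξ : V → ℕ) {v w : V} (h : v ≠ w) (x : ℕ) :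
    redistribute ξ v w x w = ξ v + ξ w - x := by
  simp [redistribute, h.symm]

lemma redistribute_of_ne (ξ : V → ℕ) {v w u : V} (hv : u ≠ v) (hw : u ≠ w) (x : ℕ) :
    redistribute ξ v w x u = ξ u := by
  simp [redistribute, hv, hw]

/-- The number of ordered pairs of distinct particles on `a` and `b`. -/
def pairCount (a b : V) (ξ : V → ℕ) : ℝ := (ξ a : ℝ) * (ξ b - if a = b then 1 else 0)

lemma pairCount_comm (a b : V) (ξ : V → ℕ) : pairCount a b ξ = pairCount b a ξ := by
  unfold pairCount
  by_cases h : a = b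
  · subst h; rfl
  · simp [h, Ne.symm h, mul_comm]

lemma ringOp_of_const {s : ℝ} (hs : 0 < s) {v w : V} {f : (V → ℕ) → ℝ} {ξ : V → ℕ} {c : ℝ}
    (h : ∀ x ≤ ξ v + ξ w, f (redistribute ξ v w x) = c) : ringOp s v w f ξ = c := by
  unfold ringOp
  rw [sum_congr rfl (fun x hx => by rw [h x (by simpa [Nat.lt_succ_iff] using hx)]), ← sum_mul,
    sum_betaBin _ hs, one_mul]

/-- A ring has one degree of freedom `x`, since the total on the edge is conserved, so occupation
numbers and pair counts become polynomials of degree at most two in `x`. The basis `x(x-1), x, 1`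
matches the factorial moments. -/
lemma ringOp_of_quadratic {s : ℝ} (hs : 0 < s) {v w : V} {f : (V → ℕ) → ℝ} {ξ : V → ℕ}
    {a b c : ℝ}
    (h : ∀ x ≤ ξ v + ξ w, f (redistribute ξ v w x) = a * (x * (x - 1)) + b * x + c) :
    ringOp s v w f ξ = a * ((s + 1) / (2 * (2 * s + 1))
      * (((ξ v + ξ w : ℕ) : ℝ) * (((ξ v + ξ w : ℕ) : ℝ) - 1)))
      + b * (((ξ v + ξ w : ℕ) : ℝ) / 2) + c := by
  have h0 := sum_betaBin (ξ v + ξ w) hs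
  have h1 := sum_betaBin_mul_id (ξ v + ξ w) hs
  have h2 := sum_betaBin_mul_id_mul_sub_one (ξ v + ξ w) hs
  rw [← h1, ← h2]
  trans a * (∑ x ∈ range (ξ v + ξ w + 1), betaBin (ξ v + ξ w) s x * (x * (x - 1)))
    + b * (∑ x ∈ range (ξ v + ξ w + 1), betaBin (ξ v + ξ w) s x * x)
    + c * (∑ x ∈ range (ξ v + ξ w + 1), betaBin (ξ v + ξ w) s x)
  swap
  · rw [h0, mul_one]
  rw [mul_sum, mul_sum, mul_sum, ← sum_add_distrib, ← sum_add_distrib]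
  unfold ringOp
  refine sum_congr rfl fun x hx => ?_
  rw [h x (by simpa [Nat.lt_succ_iff] using hx)]
  ring

lemma ringOp_linear {s : ℝ} (hs : 0 < s) {v w : V} {f : (V → ℕ) → ℝ} {ξ : V → ℕ} {b c : ℝ}
    (h : ∀ x ≤ ξ v + ξ w, f (redistribute ξ v w x) = b * x + c) :
    ringOp s v w f ξ = b * (((ξ v : ℝ) + ξ w) / 2) + c := by
  have := ringOp_of_quadratic hs (v := v) (w := w) (f := f) (ξ := ξ) (a := 0) (b := b) (c := c)
    (fun x hx => by rw [h x hx]; ring)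
  rw [this]
  push_cast
  ring

lemma ringOp_apply_of_ne {s : ℝ} (hs : 0 < s) {v w a : V} (hv : a ≠ v) (hw : a ≠ w) (ξ : V → ℕ) :
    ringOp s v w (fun η => (η a : ℝ)) ξ = ξ a :=
  ringOp_of_const hs fun x _ => by simp [redistribute_of_ne ξ hv hw]

lemma ringOp_apply_left {s : ℝ} (hs : 0 < s) (v w : V) (ξ : V → ℕ) :
    ringOp s v w (fun η => (η v : ℝ)) ξ = ((ξ v : ℝ) + ξ w) / 2 := by
  rw [ringOp_linear hs (b := 1) (c := 0) fun x _ => by simp]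
  ring

lemma ringOp_apply_right {s : ℝ} (hs : 0 < s) {v w : V} (h : v ≠ w) (ξ : V → ℕ) :
    ringOp s v w (fun η => (η w : ℝ)) ξ = ((ξ v : ℝ) + ξ w) / 2 := by
  rw [ringOp_linear hs (b := -1) (c := (ξ v : ℝ) + ξ w) fun x hx => by
    rw [redistribute_right ξ h, Nat.cast_sub hx]; push_cast; ring]
  ring

lemma ringOp_pairCount_of_ne {s : ℝ} (hs : 0 < s) {v w a b : V} (hav : a ≠ v) (haw : a ≠ w)
    (hbv : b ≠ v) (hbw : b ≠ w) (ξ : V → ℕ) :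
    ringOp s v w (pairCount a b) ξ = pairCount a b ξ :=
  ringOp_of_const hs fun x _ => by
    simp [pairCount, redistribute_of_ne ξ hav haw, redistribute_of_ne ξ hbv hbw]

lemma ringOp_pairCount_left {s : ℝ} (hs : 0 < s) {v w b : V}
    (hbv : b ≠ v) (hbw : b ≠ w) (ξ : V → ℕ) :
    ringOp s v w (pairCount v b) ξ = (pairCount v b ξ + pairCount w b ξ) / 2 := by
  rw [ringOp_linear hs (b := (ξ b : ℝ)) (c := 0) fun x _ => by
    simp [pairCount, redistribute_of_ne ξ hbv hbw, hbv.symm]; ring]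
  simp [pairCount, hbv.symm, hbw.symm]
  ring

lemma ringOp_pairCount_right {s : ℝ} (hs : 0 < s) {v w b : V} (h : v ≠ w)
    (hbv : b ≠ v) (hbw : b ≠ w) (ξ : V → ℕ) :
    ringOp s v w (pairCount w b) ξ = (pairCount v b ξ + pairCount w b ξ) / 2 := by
  rw [ringOp_linear hs (b := -(ξ b : ℝ)) (c := ξ b * ((ξ v : ℝ) + ξ w)) fun x hx => by
    simp only [pairCount, redistribute_of_ne ξ hbv hbw, redistribute_right ξ h, Nat.cast_sub hx,
      hbw.symm, if_false]
    push_cast; ring]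
  simp [pairCount, hbv.symm, hbw.symm]
  ring

/-- The bracket equals `r(r-1)` with `r` the total on the edge. A ring forgets how these pairs were
split and redistributes them in the proportions `s+1 : s : s : s+1`. -/
lemma ringOp_pairCount_left_left {s : ℝ} (hs : 0 < s) {v w : V} (h : v ≠ w) (ξ : V → ℕ) :
    ringOp s v w (pairCount v v) ξ = (s + 1) / (2 * (2 * s + 1))
      * (pairCount v v ξ + 2 * pairCount v w ξ + pairCount w w ξ) := by
  rw [ringOp_of_quadratic hs (a := 1) (b := 0) (c := 0) fun x _ => by simp [pairCount]]
  simp only [pairCount, if_true, if_neg h]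
  push_cast
  ring

lemma ringOp_pairCount_right_right {s : ℝ} (hs : 0 < s) {v w : V} (h : v ≠ w) (ξ : V → ℕ) :
    ringOp s v w (pairCount w w) ξ = (s + 1) / (2 * (2 * s + 1))
      * (pairCount v v ξ + 2 * pairCount v w ξ + pairCount w w ξ) := by
  rw [ringOp_of_quadratic hs (a := 1) (b := 2 - 2 * ((ξ v : ℝ) + ξ w))
    (c := ((ξ v : ℝ) + ξ w) * ((ξ v : ℝ) + ξ w - 1)) fun x hx => by
      simp only [pairCount, redistribute_right ξ h, Nat.cast_sub hx, if_true]
      push_cast; ring]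
  simp [pairCount, h]
  ring

lemma ringOp_pairCount_left_right {s : ℝ} (hs : 0 < s) {v w : V} (h : v ≠ w) (ξ : V → ℕ) :
    ringOp s v w (pairCount v w) ξ = s / (2 * (2 * s + 1))
      * (pairCount v v ξ + 2 * pairCount v w ξ + pairCount w w ξ) := by
  rw [ringOp_of_quadratic hs (a := -1) (b := (ξ v : ℝ) + ξ w - 1)
    (c := 0) fun x hx => by
      simp only [pairCount, redistribute_left, redistribute_right ξ h, Nat.cast_sub hx, h, if_false]
      push_cast; ring]
  have : 2 * s + 1 ≠ 0 := by positivity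
  simp [pairCount, h]
  field_simp
  ring

end ringOp

/-! ### Expectations and the transition matrix of an edge ring -/

section Config

variable {V : Type*} [Fintype V] [DecidableEq V] {m : ℕ}

/-- The sum of `f` against the weights `μ` on configurations. -/
def configSum (μ : Config V m → ℝ) (f : (V → ℕ) → ℝ) : ℝ := ∑ ξ, μ ξ * f ξ.1

lemma configSum_congr {μ : Config V m → ℝ} {f g : (V → ℕ) → ℝ}
    (h : ∀ ξ, ∑ v, ξ v = m → f ξ = g ξ) : configSum μ f = configSum μ g :=
  sum_congr rfl fun ξ _ => by rw [h ξ.1 ξ.2]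

lemma configSum_mono {μ : Config V m → ℝ} (hμ : ∀ ξ, 0 ≤ μ ξ) {f g : (V → ℕ) → ℝ}
    (h : ∀ ξ, ∑ v, ξ v = m → f ξ ≤ g ξ) : configSum μ f ≤ configSum μ g :=
  sum_le_sum fun ξ _ => mul_le_mul_of_nonneg_left (h ξ.1 ξ.2) (hμ ξ)

lemma configSum_add (μ : Config V m → ℝ) (f g : (V → ℕ) → ℝ) :
    configSum μ (fun ξ => f ξ + g ξ) = configSum μ f + configSum μ g := by
  simp [configSum, mul_add, sum_add_distrib]

lemma configSum_const_mul (μ : Config V m → ℝ) (c : ℝ) (f : (V → ℕ) → ℝ) :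
    configSum μ (fun ξ => c * f ξ) = c * configSum μ f := by
  simp only [configSum, mul_sum]
  exact sum_congr rfl fun _ _ => by ring

lemma configSum_sum {ι : Type*} (t : Finset ι) (μ : Config V m → ℝ) (f : ι → (V → ℕ) → ℝ) :
    configSum μ (fun ξ => ∑ i ∈ t, f i ξ) = ∑ i ∈ t, configSum μ (f i) := by
  simp only [configSum, mul_sum]
  exact sum_comm

lemma configSum_const {μ : Config V m → ℝ} (hμ : ∑ ξ, μ ξ = 1) (c : ℝ) :
    configSum μ (fun _ => c) = c := by
  rw [configSum, ← sum_mul, hμ, one_mul]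

lemma sum_eq_add_add_sum_erase {M : Type*} [AddCommMonoid M] {v w : V} (h : v ≠ w) (f : V → M) :
    ∑ u, f u = f v + (f w + ∑ u ∈ (univ.erase v).erase w, f u) := by
  rw [add_sum_erase _ _ (by simp [h.symm]), add_sum_erase _ _ (mem_univ v)]

lemma sum_redistribute {v w : V} (h : v ≠ w) (ξ : V → ℕ) {x : ℕ} (hx : x ≤ ξ v + ξ w) :
    ∑ u, redistribute ξ v w x u = ∑ u, ξ u := by
  rw [sum_eq_add_add_sum_erase h, sum_eq_add_add_sum_erase h ξ, redistribute_left,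
    redistribute_right ξ h]
  have hrest : ∑ u ∈ (univ.erase v).erase w, redistribute ξ v w x u
      = ∑ u ∈ (univ.erase v).erase w, ξ u := by
    refine sum_congr rfl fun u hu => ?_
    simp only [mem_erase] at hu
    exact redistribute_of_ne ξ hu.2.1 hu.1 x
  rw [hrest]
  omega

/-- The transition matrix of a ring of the edge `{v, w}`. -/
noncomputable def ringMatrix (s : ℝ) (m : ℕ) (v w : V) : Matrix (Config V m) (Config V m) ℝ :=
  fun ξ ξ' => ringProb s v w ξ.1 ξ'.1

lemma ringMatrix_nonneg {s : ℝ} (hs : 0 < s) (v w : V) (ξ ξ' : Config V m) :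
    0 ≤ ringMatrix s m v w ξ ξ' := by
  unfold ringMatrix ringProb
  refine sum_nonneg fun x _ => ?_
  split_ifs
  exacts [betaBin_nonneg _ hs x, le_rfl]

lemma sum_ringMatrix_mul (s : ℝ) {v w : V} (h : v ≠ w) (ξ : Config V m) (f : (V → ℕ) → ℝ) :
    ∑ ξ', ringMatrix s m v w ξ ξ' * f ξ'.1 = ringOp s v w f ξ.1 := by
  simp only [ringMatrix, ringProb, ringOp, sum_mul]
  rw [sum_comm]
  refine sum_congr rfl fun x hx => ?_
  have hx' : x ≤ ξ.1 v + ξ.1 w := by simpa [Nat.lt_succ_iff] using hx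
  have hm : ∑ u, redistribute ξ.1 v w x u = m := (sum_redistribute h ξ.1 hx').trans ξ.2
  rw [sum_eq_single (⟨redistribute ξ.1 v w x, hm⟩ : Config V m)]
  · simp
  · intro ξ' _ hne
    rw [if_neg, zero_mul]
    intro heq
    exact hne (Subtype.ext heq.symm)
  · simp

lemma configSum_vecMul_ringMatrix (s : ℝ) {v w : V} (h : v ≠ w) (μ : Config V m → ℝ)
    (f : (V → ℕ) → ℝ) :
    configSum (μ ᵥ* ringMatrix s m v w) f = configSum μ (ringOp s v w f) := by
  simp only [configSum, vecMul, dotProduct, sum_mul]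
  rw [sum_comm]
  refine sum_congr rfl fun ξ _ => ?_
  rw [← sum_ringMatrix_mul s h ξ f, mul_sum]
  exact sum_congr rfl fun _ _ => by ring

lemma sum_ringMatrix {s : ℝ} (hs : 0 < s) {v w : V} (h : v ≠ w) (ξ : Config V m) :
    ∑ ξ', ringMatrix s m v w ξ ξ' = 1 := by
  have := sum_ringMatrix_mul s h ξ (fun _ => 1)
  simp only [mul_one] at this
  rw [this]
  exact ringOp_of_const hs fun _ _ => rfl

/-! ### Stationarity of the equilibrium distribution -/

lemma ringProb_eq (s : ℝ) {v w : V} (h : v ≠ w) (ξ ξ' : V → ℕ) :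
    ringProb s v w ξ ξ' = if (∀ u, u ≠ v → u ≠ w → ξ' u = ξ u) ∧ ξ' v + ξ' w = ξ v + ξ w then
      betaBin (ξ v + ξ w) s (ξ' v) else 0 := by
  unfold ringProb
  split_ifs with hc
  · rw [sum_eq_single (ξ' v)]
    · rw [if_pos]
      funext u
      by_cases hv : u = v
      · subst hv; simp
      by_cases hw : u = w
      · subst hw
        rw [redistribute_right ξ h]
        omega
      rw [redistribute_of_ne ξ hv hw, hc.1 u hv hw]
    · intro x _ hx
      rw [if_neg]
      rintro rfl
      simp at hx
    · intro hx
      simp only [mem_range] at hx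
      omega
  · refine sum_eq_zero fun x hx => if_neg ?_
    rintro rfl
    have hx' : x ≤ ξ v + ξ w := by simpa [Nat.lt_succ_iff] using hx
    refine hc ⟨fun u hv hw => redistribute_of_ne ξ hv hw x, ?_⟩
    rw [redistribute_left, redistribute_right ξ h]
    omega

/-- Up to a factor depending only on `x + y`, the beta-binomial weight is the product of the two
vertex weights of the equilibrium. A ring thus resamples the edge from the conditional equilibrium
law, whence detailed balance. -/
lemma betaBin_add_left (s : ℝ) (x y : ℕ) :
    betaBin (x + y) s x = ((x + y).factorial : ℝ) / Real.Gamma (((x + y : ℕ) : ℝ) + 2 * s)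
      / ProbabilityTheory.beta s s * (Real.Gamma (s + x) / x.factorial)
      * (Real.Gamma (s + y) / y.factorial) := by
  unfold betaBin
  rw [Nat.choose_symm_add, Nat.add_choose, Nat.add_sub_cancel_left,
    Nat.cast_div (Nat.factorial_mul_factorial_dvd_factorial_add x y) (by positivity)]
  conv_lhs => rw [ProbabilityTheory.beta]
  rw [show (x : ℝ) + s + (y + s) = ((x + y : ℕ) : ℝ) + 2 * s by push_cast; ring, add_comm s,
    add_comm s]
  push_cast
  field_simp

lemma weightBB_mul_ringProb (s : ℝ) {v w : V} (h : v ≠ w) (ξ ξ' : V → ℕ) :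
    weightBB s ξ * ringProb s v w ξ ξ' = weightBB s ξ' * ringProb s v w ξ' ξ := by
  rw [ringProb_eq s h, ringProb_eq s h]
  by_cases hc : (∀ u, u ≠ v → u ≠ w → ξ' u = ξ u) ∧ ξ' v + ξ' w = ξ v + ξ w
  · rw [if_pos hc, if_pos ⟨fun u h1 h2 => (hc.1 u h1 h2).symm, hc.2.symm⟩]
    have hprod : ∀ η : V → ℕ, weightBB s η
        = Real.Gamma (s + η v) / (η v).factorial * (Real.Gamma (s + η w) / (η w).factorial
          * ∏ u ∈ (univ.erase v).erase w, Real.Gamma (s + η u) / ((η u).factorial : ℝ)) := by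
      intro η
      rw [weightBB, mul_prod_erase _ (fun u => Real.Gamma (s + η u) / ((η u).factorial : ℝ))
        (by simp [h.symm]), mul_prod_erase _ (fun u => Real.Gamma (s + η u)
        / ((η u).factorial : ℝ)) (mem_univ v)]
    rw [hprod ξ, hprod ξ']
    have hrest : ∏ u ∈ (univ.erase v).erase w, Real.Gamma (s + ξ' u) / ((ξ' u).factorial : ℝ)
        = ∏ u ∈ (univ.erase v).erase w, Real.Gamma (s + ξ u) / ((ξ u).factorial : ℝ) := by
      refine prod_congr rfl fun u hu => ?_
      simp only [mem_erase] at hu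
      rw [hc.1 u hu.2.1 hu.1]
    have h1 := betaBin_add_left s (ξ' v) (ξ' w)
    rw [hc.2] at h1
    rw [hrest, hc.2, h1, betaBin_add_left s (ξ v) (ξ w)]
    ring
  · rw [if_neg hc, if_neg fun h' => hc ⟨fun u h1 h2 => (h'.1 u h1 h2).symm, h'.2.symm⟩]
    simp

omit [DecidableEq V] in
lemma weightBB_pos {s : ℝ} (hs : 0 < s) (ξ : V → ℕ) : 0 < weightBB s ξ :=
  prod_pos fun v _ => div_pos (Real.Gamma_pos_of_pos (by positivity)) (by positivity)

lemma equilibriumBB_nonneg {s : ℝ} (hs : 0 < s) (ξ : Config V m) : 0 ≤ equilibriumBB V s m ξ :=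
  div_nonneg (weightBB_pos hs _).le (sum_nonneg fun _ _ => (weightBB_pos hs _).le)

lemma sum_equilibriumBB [Nonempty V] {s : ℝ} (hs : 0 < s) :
    ∑ ξ, equilibriumBB V s m ξ = 1 := by
  unfold equilibriumBB
  rw [← sum_div]
  have : Nonempty (Config V m) :=
    ⟨⟨fun u => if u = Classical.arbitrary V then m else 0, by simp⟩⟩
  exact div_self (sum_pos (fun _ _ => weightBB_pos hs _) univ_nonempty).ne'

lemma equilibriumBB_vecMul_ringMatrix {s : ℝ} (hs : 0 < s) {v w : V} (h : v ≠ w) :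
    equilibriumBB V s m ᵥ* ringMatrix s m v w = equilibriumBB V s m := by
  funext ξ'
  simp only [vecMul, dotProduct]
  rw [← mul_one (equilibriumBB V s m ξ'), ← sum_ringMatrix hs h ξ', mul_sum]
  refine sum_congr rfl fun ξ _ => ?_
  simp only [equilibriumBB, ringMatrix]
  rw [div_mul_eq_mul_div, weightBB_mul_ringProb s h, div_mul_eq_mul_div]

/-- No adjacency is required: the equilibrium is invariant under a ring of any two distinct
vertices. This gives its one- and two-point functions by symmetry, without computing the normalizing
sum. -/
lemma configSum_equilibriumBB_ringOp {s : ℝ} (hs : 0 < s) {v w : V} (h : v ≠ w)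
    (f : (V → ℕ) → ℝ) :
    configSum (equilibriumBB V s m) (ringOp s v w f) = configSum (equilibriumBB V s m) f := by
  rw [← configSum_vecMul_ringMatrix s h, equilibriumBB_vecMul_ringMatrix hs h]

/-! ### Second moments of linear statistics -/

/-- The linear statistic `∑ v, φ v * ξ v`. -/
def linStat (φ : V → ℝ) (ξ : V → ℕ) : ℝ := ∑ v, φ v * ξ v

lemma linStat_sq (φ : V → ℝ) (ξ : V → ℕ) :
    linStat φ ξ ^ 2
      = ∑ a, ∑ b, φ a * φ b * pairCount a b ξ + ∑ a, φ a ^ 2 * ξ a := by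
  have : ∀ a, ∑ b, φ a * φ b * pairCount a b ξ
      = φ a * ξ a * linStat φ ξ - φ a ^ 2 * ξ a := by
    intro a
    simp only [linStat, mul_sum, pairCount]
    rw [← sum_add_sum_compl {a}, ← sum_add_sum_compl {a} (fun b => φ a * ξ a * (φ b * ξ b))]
    simp only [sum_singleton, if_true]
    rw [sum_congr rfl (g := fun b => φ a * ξ a * (φ b * ξ b))]
    · ring
    · intro b hb
      have : a ≠ b := by simpa [eq_comm] using hb
      simp only [this, if_false]
      ring
  simp only [this, sum_sub_distrib, ← sum_mul]
  rw [sub_add_cancel, sq]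
  rfl

lemma configSum_linStat (μ : Config V m → ℝ) (φ : V → ℝ) :
    configSum μ (linStat φ) = ∑ a, φ a * configSum μ (fun ξ => (ξ a : ℝ)) := by
  unfold linStat
  rw [configSum_sum]
  exact sum_congr rfl fun a _ => configSum_const_mul _ _ _

lemma configSum_linStat_sq (μ : Config V m → ℝ) (φ : V → ℝ) :
    configSum μ (fun ξ => linStat φ ξ ^ 2)
      = ∑ a, ∑ b, φ a * φ b * configSum μ (pairCount a b)
        + ∑ a, φ a ^ 2 * configSum μ (fun ξ => (ξ a : ℝ)) := by
  rw [funext (linStat_sq φ), configSum_add, configSum_sum, configSum_sum]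
  congr 1
  · refine sum_congr rfl fun a _ => ?_
    rw [configSum_sum]
    exact sum_congr rfl fun b _ => configSum_const_mul _ _ _
  · exact sum_congr rfl fun a _ => configSum_const_mul _ _ _

lemma sum_pairCount {ξ : V → ℕ} (h : ∑ v, ξ v = m) :
    ∑ a, ∑ b, pairCount a b ξ = (m : ℝ) * (m - 1) := by
  have hm : ∑ v, (ξ v : ℝ) = m := by exact_mod_cast h
  simp only [pairCount, ← mul_sum, sum_sub_distrib, hm, sum_ite_eq, mem_univ, if_true, ← sum_mul]

lemma configSum_equilibriumBB_apply_eq {s : ℝ} (hs : 0 < s) (v w : V) :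
    configSum (equilibriumBB V s m) (fun ξ => (ξ v : ℝ))
      = configSum (equilibriumBB V s m) (fun ξ => (ξ w : ℝ)) := by
  by_cases h : v = w
  · rw [h]
  rw [← configSum_equilibriumBB_ringOp hs h, ← configSum_equilibriumBB_ringOp hs h (fun ξ => (ξ w : ℝ)),
    funext (ringOp_apply_left hs v w), funext (ringOp_apply_right hs h)]

lemma configSum_equilibriumBB_pairCount_self_eq {s : ℝ} (hs : 0 < s) (v w : V) :
    configSum (equilibriumBB V s m) (pairCount v v)
      = configSum (equilibriumBB V s m) (pairCount w w) := by
  by_cases h : v = w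
  · rw [h]
  rw [← configSum_equilibriumBB_ringOp hs h, ← configSum_equilibriumBB_ringOp hs h (pairCount w w),
    funext (ringOp_pairCount_left_left hs h), funext (ringOp_pairCount_right_right hs h)]

/-- After a ring of `{v, w}` both pair counts are multiples of the same quantity, with coefficients
in the ratio `s : s + 1`. -/
lemma configSum_equilibriumBB_pairCount_of_ne {s : ℝ} (hs : 0 < s) {v w : V} (h : v ≠ w) :
    (s + 1) * configSum (equilibriumBB V s m) (pairCount v w)
      = s * configSum (equilibriumBB V s m) (pairCount v v) := by
  rw [← configSum_equilibriumBB_ringOp hs h, ← configSum_equilibriumBB_ringOp hs h (pairCount v v),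
    funext (ringOp_pairCount_left_left hs h), funext (ringOp_pairCount_left_right hs h),
    configSum_const_mul, configSum_const_mul]
  ring

lemma nonneg_of_mul_eq {n s D : ℝ} {m : ℕ} (hn : 0 < n) (hs : 0 < s)
    (h : D * (n * (n * s + 1)) = m * (m - 1)) : 0 ≤ D := by
  refine nonneg_of_mul_nonneg_left (b := n * (n * s + 1)) (h ▸ ?_) (by positivity)
  rcases m with _ | k
  · simp
  · push_cast; rw [add_sub_cancel_right]; positivity

lemma mul_le_sq_div_of_mul_eq {n s D : ℝ} {m : ℕ} (hn : 0 < n) (hs : 0 < s)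
    (h : D * (n * (n * s + 1)) = m * (m - 1)) : n * D ≤ (m : ℝ) ^ 2 / (n * s) := by
  have hD := nonneg_of_mul_eq hn hs h
  rw [le_div_iff₀ (by positivity)]
  nlinarith [mul_nonneg hn.le hD, (Nat.cast_nonneg m : (0 : ℝ) ≤ m)]

/-- The two-point function is `D * (s + 1_{a = b})`. Its constant part is killed by `∑ φ = 0`, so
only `∑ φ² * (D + B)` remains; `D` and `B` follow from the deterministic numbers of pairs and of
particles. -/
lemma configSum_equilibriumBB_linStat_sq_le [Nonempty V] {s : ℝ} (hs : 0 < s) {φ : V → ℝ}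
    (hφ : ∀ v, |φ v| ≤ 1) (hφ0 : ∑ v, φ v = 0) :
    configSum (equilibriumBB V s m) (fun ξ => linStat φ ξ ^ 2)
      ≤ (m : ℝ) ^ 2 / (Fintype.card V * s) + m := by
  set π := equilibriumBB V s m
  set n : ℝ := (Fintype.card V : ℝ)
  have hn : 0 < n := by simpa [n] using Fintype.card_pos
  have hπ : ∑ ξ, π ξ = 1 := sum_equilibriumBB hs
  let v₀ : V := Classical.arbitrary V
  set D := configSum π (pairCount v₀ v₀) / (s + 1)
  set B := configSum π (fun ξ => (ξ v₀ : ℝ))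
  have hB : ∀ a, configSum π (fun ξ => (ξ a : ℝ)) = B := fun a => configSum_equilibriumBB_apply_eq hs a v₀
  have hD : ∀ a b, configSum π (pairCount a b) = D * (s + if a = b then 1 else 0) := by
    intro a b
    have haa : configSum π (pairCount a a) = D * (s + 1) := by
      rw [div_mul_cancel₀ _ (by positivity)]
      exact configSum_equilibriumBB_pairCount_self_eq hs a v₀
    by_cases hab : a = b
    · subst hab; simpa using haa
    · have := configSum_equilibriumBB_pairCount_of_ne (m := m) hs hab
      rw [haa] at this
      have h1 : s + 1 ≠ 0 := by positivity
      rw [if_neg hab, add_zero]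
      apply mul_left_cancel₀ h1
      rw [this]
      ring
  have hBsum : n * B = m := by
    rw [← configSum_const hπ (m : ℝ)]
    rw [configSum_congr (g := fun ξ => ∑ v, (ξ v : ℝ)) (fun ξ h => by exact_mod_cast h.symm),
      configSum_sum, sum_congr rfl fun a _ => hB a]
    simp [n]
  have hDsum : D * (n * (n * s + 1)) = m * (m - 1) := by
    rw [← configSum_const hπ ((m : ℝ) * (m - 1)),
      configSum_congr (g := fun ξ => ∑ a, ∑ b, pairCount a b ξ) (fun ξ h => (sum_pairCount h).symm),
      configSum_sum]
    simp only [configSum_sum, hD, ← mul_sum, sum_add_distrib, sum_const, sum_ite_eq, mem_univ,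
      if_true, card_univ, nsmul_eq_mul]
    ring
  rw [configSum_linStat_sq]
  simp only [hB, hD]
  have h1 : ∑ a, ∑ b, φ a * φ b * (D * (s + if a = b then 1 else 0)) = D * ∑ a, φ a ^ 2 := by
    rw [mul_sum]
    refine sum_congr rfl fun a _ => ?_
    trans φ a * D * s * ∑ b, φ b + ∑ b, if a = b then φ a * φ b * D else 0
    · rw [mul_sum, ← sum_add_distrib]
      refine sum_congr rfl fun b _ => ?_
      split_ifs <;> ring
    · rw [hφ0]
      simp
      ring
  rw [h1, ← sum_mul, mul_comm D, ← mul_add]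
  have hS : ∑ a, φ a ^ 2 ≤ n := by
    calc ∑ a, φ a ^ 2 ≤ ∑ _a : V, (1 : ℝ) := sum_le_sum fun a _ => by
          rw [sq_le_one_iff_abs_le_one]; exact hφ a
      _ = n := by simp [n]
  have hnD := mul_le_sq_div_of_mul_eq hn hs hDsum
  have hDn : 0 ≤ D := nonneg_of_mul_eq hn hs hDsum
  have hBn : 0 ≤ B := nonneg_of_mul_nonneg_right (hBsum ▸ Nat.cast_nonneg m) hn
  calc (∑ a, φ a ^ 2) * (D + B) ≤ n * (D + B) :=
        mul_le_mul_of_nonneg_right hS (add_nonneg hDn hBn)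
    _ = n * D + m := by rw [mul_add, hBsum]
    _ ≤ _ := add_le_add_left hnD _

end Config

/-! ### One step of the discrete skeleton -/

section Step

variable {V : Type*} [Fintype V] [DecidableEq V] {m : ℕ} {ι : Type*} [Fintype ι]

/-- The transition matrix that rings an edge chosen uniformly from the family `{e₁ i, e₂ i}`. -/
noncomputable def stepMatrix (s : ℝ) (m : ℕ) (e₁ e₂ : ι → V) :
    Matrix (Config V m) (Config V m) ℝ :=
  (Fintype.card ι : ℝ)⁻¹ • ∑ i, ringMatrix s m (e₁ i) (e₂ i)

lemma configSum_vecMul_stepMatrix (s : ℝ) {e₁ e₂ : ι → V} (he : ∀ i, e₁ i ≠ e₂ i)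
    (μ : Config V m → ℝ) (f : (V → ℕ) → ℝ) :
    configSum (μ ᵥ* stepMatrix s m e₁ e₂) f
      = (Fintype.card ι : ℝ)⁻¹ * ∑ i, configSum μ (ringOp s (e₁ i) (e₂ i) f) := by
  have h : μ ᵥ* stepMatrix s m e₁ e₂
      = fun ξ => (Fintype.card ι : ℝ)⁻¹ * ∑ i, (μ ᵥ* ringMatrix s m (e₁ i) (e₂ i)) ξ := by
    funext ξ
    rw [stepMatrix, vecMul_smul, vecMul_sum]
    simp
  rw [h]
  simp only [configSum, mul_assoc, ← mul_sum, sum_mul]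
  rw [sum_comm]
  congr 1
  exact sum_congr rfl fun i _ => configSum_vecMul_ringMatrix s (he i) μ f

/-- `μ` is a probability mass function with mean occupation numbers at most `B` and two-point
function at most `A` times the one of the equilibrium. -/
structure MomentBound (s A B : ℝ) (μ : Config V m → ℝ) : Prop where
  nonneg : ∀ ξ, 0 ≤ μ ξ
  sum_eq_one : ∑ ξ, μ ξ = 1
  apply_le : ∀ a, configSum μ (fun ξ => (ξ a : ℝ)) ≤ B
  pairCount_le : ∀ a b, configSum μ (pairCount a b) ≤ A * (s + if a = b then 1 else 0)

lemma configSum_ringOp_apply_le {s : ℝ} (hs : 0 < s) {B : ℝ} {μ : Config V m → ℝ}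
    (hB : ∀ a, configSum μ (fun ξ => (ξ a : ℝ)) ≤ B) {v w : V} (h : v ≠ w) (a : V) :
    configSum μ (ringOp s v w fun ξ => (ξ a : ℝ)) ≤ B := by
  have havg : configSum μ (fun ξ => ((ξ v : ℝ) + ξ w) / 2) ≤ B := by
    simp only [div_eq_inv_mul, configSum_const_mul, configSum_add]
    linarith [hB v, hB w]
  by_cases hv : a = v
  · subst hv
    rwa [funext (ringOp_apply_left hs a w)]
  by_cases hw : a = w
  · subst hw
    rwa [funext (ringOp_apply_right hs h)]
  rw [funext (ringOp_apply_of_ne hs hv hw)]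
  exact hB a

/-- The ring acts on pair counts with nonnegative coefficients and fixes the profile `s + 1_{a =
b}`, so domination by a multiple of it is preserved. The cases record the position of `a, b`
relative to the edge. -/
lemma configSum_ringOp_pairCount_le {s : ℝ} (hs : 0 < s) {A : ℝ} {μ : Config V m → ℝ}
    (hA : ∀ a b, configSum μ (pairCount a b) ≤ A * (s + if a = b then 1 else 0)) {v w : V}
    (h : v ≠ w) (a b : V) :
    configSum μ (ringOp s v w (pairCount a b)) ≤ A * (s + if a = b then 1 else 0) := by
  have h2s : 0 < 2 * (2 * s + 1) := by positivity
  -- The profile on the edge adds up to `(s+1) + 2s + (s+1) = 2(2s+1)`, which cancels the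
  -- denominator of the ring coefficients.
  have hpair : configSum μ
      (fun ξ => pairCount v v ξ + 2 * pairCount v w ξ + pairCount w w ξ)
        ≤ A * (2 * (2 * s + 1)) := by
    simp only [configSum_const_mul, configSum_add]
    have h1 := hA v v
    have h2 := hA w w
    have h3 := hA v w
    simp only [if_true, if_neg h] at h1 h2 h3
    linarith
  have hdiag : configSum μ (fun ξ => (s + 1) / (2 * (2 * s + 1)) *
      (pairCount v v ξ + 2 * pairCount v w ξ + pairCount w w ξ)) ≤ A * (s + 1) := by
    rw [configSum_const_mul]
    calc _ ≤ (s + 1) / (2 * (2 * s + 1)) * (A * (2 * (2 * s + 1))) := by gcongr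
      _ = A * (s + 1) := by field_simp
  have hoff : configSum μ (fun ξ => s / (2 * (2 * s + 1)) *
      (pairCount v v ξ + 2 * pairCount v w ξ + pairCount w w ξ)) ≤ A * s := by
    rw [configSum_const_mul]
    calc _ ≤ s / (2 * (2 * s + 1)) * (A * (2 * (2 * s + 1))) := by gcongr
      _ = A * s := by field_simp
  have hone : ∀ c, c ≠ v → c ≠ w →
      configSum μ (fun ξ => (pairCount v c ξ + pairCount w c ξ) / 2) ≤ A * s := by
    intro c hcv hcw
    simp only [div_eq_inv_mul, configSum_const_mul, configSum_add]
    have h1 := hA v c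
    have h2 := hA w c
    simp only [if_neg hcv.symm, if_neg hcw.symm] at h1 h2
    linarith
  have hcomm : ∀ a b : V, (pairCount a b : (V → ℕ) → ℝ) = pairCount b a :=
    fun a b => funext (pairCount_comm a b)
  by_cases hav : a = v
  · subst hav
    by_cases hba : b = a
    · subst hba
      rw [funext (ringOp_pairCount_left_left hs h), if_pos rfl]
      exact hdiag
    by_cases hbw : b = w
    · subst hbw
      rw [funext (ringOp_pairCount_left_right hs h), if_neg h, add_zero]
      exact hoff
    rw [funext (ringOp_pairCount_left hs hba hbw), if_neg (Ne.symm hba), add_zero]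
    exact hone b hba hbw
  by_cases haw : a = w
  · subst haw
    by_cases hba : b = a
    · subst hba
      rw [funext (ringOp_pairCount_right_right hs h), if_pos rfl]
      exact hdiag
    by_cases hbv : b = v
    · subst hbv
      rw [hcomm, funext (ringOp_pairCount_left_right hs h), if_neg h.symm, add_zero]
      exact hoff
    rw [funext (ringOp_pairCount_right hs h hbv hba), if_neg (Ne.symm hba), add_zero]
    exact hone b hbv hba
  by_cases hbv : b = v
  · subst hbv
    rw [hcomm, funext (ringOp_pairCount_left hs hav haw), if_neg hav, add_zero]
    exact hone a hav haw
  by_cases hbw : b = w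
  · subst hbw
    rw [hcomm, funext (ringOp_pairCount_right hs h hav haw), if_neg haw, add_zero]
    exact hone a hav haw
  rw [funext (ringOp_pairCount_of_ne hs hav haw hbv hbw)]
  exact hA a b

lemma inv_card_mul_sum_le [Nonempty ι] {f : ι → ℝ} {c : ℝ} (h : ∀ i, f i ≤ c) :
    (Fintype.card ι : ℝ)⁻¹ * ∑ i, f i ≤ c := by
  have hc : (0 : ℝ) < Fintype.card ι := by exact_mod_cast Fintype.card_pos
  rw [inv_mul_le_iff₀ hc]
  calc ∑ i, f i ≤ ∑ _i : ι, c := sum_le_sum fun i _ => h i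
    _ = _ := by simp

lemma inv_card_mul_sum_const [Nonempty ι] (c : ℝ) :
    (Fintype.card ι : ℝ)⁻¹ * ∑ _i : ι, c = c := by
  have hc : (0 : ℝ) < Fintype.card ι := by exact_mod_cast Fintype.card_pos
  rw [sum_const, card_univ, nsmul_eq_mul, inv_mul_cancel_left₀ hc.ne']

lemma MomentBound.vecMul_stepMatrix [Nonempty ι] {s : ℝ} (hs : 0 < s) {e₁ e₂ : ι → V}
    (he : ∀ i, e₁ i ≠ e₂ i) {A B : ℝ} {μ : Config V m → ℝ} (hμ : MomentBound s A B μ) :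
    MomentBound s A B (μ ᵥ* stepMatrix s m e₁ e₂) where
  nonneg ξ := by
    refine sum_nonneg fun ξ' _ => mul_nonneg (hμ.nonneg ξ') ?_
    simp only [stepMatrix, Matrix.smul_apply, Matrix.sum_apply, smul_eq_mul]
    exact mul_nonneg (by positivity) (sum_nonneg fun i _ => ringMatrix_nonneg hs _ _ _ _)
  sum_eq_one := by
    have h := configSum_vecMul_stepMatrix s he μ (fun _ => 1)
    have h1 : ∀ i, ringOp s (e₁ i) (e₂ i) (fun _ => (1 : ℝ)) = fun _ => 1 := fun i =>
      funext fun ξ => ringOp_of_const hs fun _ _ => rfl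
    simp only [h1, configSum_const hμ.sum_eq_one, inv_card_mul_sum_const] at h
    simpa [configSum] using h
  apply_le a := by
    rw [configSum_vecMul_stepMatrix s he]
    exact inv_card_mul_sum_le fun i => configSum_ringOp_apply_le hs hμ.apply_le (he i) a
  pairCount_le a b := by
    rw [configSum_vecMul_stepMatrix s he]
    exact inv_card_mul_sum_le fun i => configSum_ringOp_pairCount_le hs hμ.pairCount_le (he i) a b

lemma linStat_redistribute (φ : V → ℝ) {v w : V} (h : v ≠ w) (ξ : V → ℕ) {x : ℕ}
    (hx : x ≤ ξ v + ξ w) :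
    linStat φ (redistribute ξ v w x) = linStat φ ξ + (φ v - φ w) * (x - ξ v) := by
  unfold linStat
  rw [sum_eq_add_add_sum_erase h, sum_eq_add_add_sum_erase h (fun u => φ u * (ξ u : ℝ)),
    redistribute_left, redistribute_right ξ h, Nat.cast_sub hx]
  have hrest : ∑ u ∈ (univ.erase v).erase w, φ u * (redistribute ξ v w x u : ℝ)
      = ∑ u ∈ (univ.erase v).erase w, φ u * (ξ u : ℝ) := by
    refine sum_congr rfl fun u hu => ?_
    simp only [mem_erase] at hu
    rw [redistribute_of_ne ξ hu.2.1 hu.1 x]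
  rw [hrest]
  push_cast
  ring

lemma ringOp_linStat {s : ℝ} (hs : 0 < s) (φ : V → ℝ) {v w : V} (h : v ≠ w) (ξ : V → ℕ) :
    ringOp s v w (linStat φ) ξ = linStat φ ξ + (φ v - φ w) * (ξ w - ξ v) / 2 := by
  rw [ringOp_linear hs (b := φ v - φ w) (c := linStat φ ξ - (φ v - φ w) * ξ v) fun x hx => by
    rw [linStat_redistribute φ h ξ hx]; ring]
  ring

omit [Fintype V] in
lemma ringOp_mono {s : ℝ} (hs : 0 < s) {v w : V} {f g : (V → ℕ) → ℝ} {ξ : V → ℕ}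
    (h : ∀ x ≤ ξ v + ξ w, f (redistribute ξ v w x) ≤ g (redistribute ξ v w x)) :
    ringOp s v w f ξ ≤ ringOp s v w g ξ :=
  sum_le_sum fun x hx => mul_le_mul_of_nonneg_left
    (h x (by simpa [Nat.lt_succ_iff] using hx)) (betaBin_nonneg _ hs x)

/-- The increment of `linStat φ` is `d * (x - ξ v)`. The cross term is kept exact, as it must
produce the decay rate; only the squared increment is bounded crudely. -/
lemma ringOp_linStat_sq_le {s : ℝ} (hs : 0 < s) (φ : V → ℝ) {v w : V} (h : v ≠ w) (ξ : V → ℕ) :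
    ringOp s v w (fun η => linStat φ η ^ 2) ξ
      ≤ linStat φ ξ ^ 2 + 2 * linStat φ ξ * ((φ v - φ w) * (ξ w - ξ v) / 2)
        + (φ v - φ w) ^ 2 * (2 * ((ξ v : ℝ) ^ 2 + ξ w ^ 2)) := by
  set F := linStat φ ξ
  set d := φ v - φ w
  have hlin := ringOp_linear hs (v := v) (w := w) (ξ := ξ) (b := 2 * F * d)
    (c := F ^ 2 - 2 * F * d * ξ v + d ^ 2 * (2 * ((ξ v : ℝ) ^ 2 + ξ w ^ 2)))
    (f := fun η => 2 * F * d * η v + (F ^ 2 - 2 * F * d * ξ v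
      + d ^ 2 * (2 * ((ξ v : ℝ) ^ 2 + ξ w ^ 2)))) (fun x _ => by simp)
  refine (ringOp_mono hs (g := fun η => 2 * F * d * η v + (F ^ 2 - 2 * F * d * ξ v
      + d ^ 2 * (2 * ((ξ v : ℝ) ^ 2 + ξ w ^ 2)))) fun x hx => ?_).trans (le_of_eq ?_)
  · simp only [redistribute_left]
    rw [linStat_redistribute φ h ξ hx]
    have hx' : (x : ℝ) ≤ ξ v + ξ w := by exact_mod_cast hx
    have h0 : (0 : ℝ) ≤ x := Nat.cast_nonneg x
    have hv : (0 : ℝ) ≤ ξ v := Nat.cast_nonneg _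
    have hw : (0 : ℝ) ≤ ξ w := Nat.cast_nonneg _
    have hsq : ((x : ℝ) - ξ v) ^ 2 ≤ 2 * ((ξ v : ℝ) ^ 2 + ξ w ^ 2) := by
      have : ((x : ℝ) - ξ v) ^ 2 ≤ ((ξ v : ℝ) + ξ w) ^ 2 :=
        sq_le_sq' (by linarith) (by linarith)
      nlinarith [sq_nonneg ((ξ v : ℝ) - ξ w)]
    have := mul_le_mul_of_nonneg_left hsq (sq_nonneg d)
    change (F + d * (x - ξ v)) ^ 2 ≤ _
    linarith
  · rw [hlin]
    ring

/-- `φ` is an eigenfunction of the random walk that moves by averaging along the edges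
`{e₁ i, e₂ i}`, in weak form, with eigenvalue `-lam`. -/
def IsEdgeEigenfunction (e₁ e₂ : ι → V) (φ : V → ℝ) (lam : ℝ) : Prop :=
  ∀ x : V → ℝ, (Fintype.card ι : ℝ)⁻¹ * ∑ i, (φ (e₁ i) - φ (e₂ i)) * (x (e₂ i) - x (e₁ i)) / 2
    = -lam * ∑ v, φ v * x v

lemma configSum_vecMul_stepMatrix_linStat [Nonempty ι] {s : ℝ} (hs : 0 < s) {e₁ e₂ : ι → V}
    (he : ∀ i, e₁ i ≠ e₂ i) {φ : V → ℝ} {lam : ℝ} (hφ : IsEdgeEigenfunction e₁ e₂ φ lam)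
    (μ : Config V m → ℝ) :
    configSum (μ ᵥ* stepMatrix s m e₁ e₂) (linStat φ) = (1 - lam) * configSum μ (linStat φ) := by
  rw [configSum_vecMul_stepMatrix s he, ← configSum_sum, ← configSum_const_mul,
    ← configSum_const_mul]
  refine configSum_congr fun ξ _ => ?_
  have h := hφ (fun v => (ξ v : ℝ))
  simp only [fun i => ringOp_linStat hs φ (he i) ξ, sum_add_distrib, mul_add,
    inv_card_mul_sum_const, h]
  simp only [linStat]
  ring

/-- The cross terms sum, by the eigenfunction relation, to exactly `-2 * lam * F²`. The rest is
noise: `δ²` times the occupation second moments, which `MomentBound` controls at every time; `hdeg`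
says that each vertex meets at most two edges. -/
lemma MomentBound.configSum_linStat_sq_vecMul_le [Nonempty ι] {s : ℝ} (hs : 0 < s)
    {e₁ e₂ : ι → V} (he : ∀ i, e₁ i ≠ e₂ i) {φ : V → ℝ} {lam δ : ℝ}
    (hφ : IsEdgeEigenfunction e₁ e₂ φ lam) (hδ : ∀ i, |φ (e₁ i) - φ (e₂ i)| ≤ δ)
    (hdeg : ∀ x : V → ℝ, ∑ i, (x (e₁ i) ^ 2 + x (e₂ i) ^ 2) ≤ 2 * ∑ v, x v ^ 2)
    {A B : ℝ} {μ : Config V m → ℝ} (hμ : MomentBound s A B μ) :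
    configSum (μ ᵥ* stepMatrix s m e₁ e₂) (fun ξ => linStat φ ξ ^ 2)
      ≤ (1 - 2 * lam) * configSum μ (fun ξ => linStat φ ξ ^ 2)
        + (Fintype.card ι : ℝ)⁻¹ * δ ^ 2 * 4 * (Fintype.card V * (B + A * (s + 1))) := by
  have hc : (0 : ℝ) ≤ (Fintype.card ι : ℝ)⁻¹ := by positivity
  rw [configSum_vecMul_stepMatrix s he, ← configSum_sum, ← configSum_const_mul]
  have hpt : ∀ ξ : V → ℕ, (Fintype.card ι : ℝ)⁻¹
      * ∑ i, ringOp s (e₁ i) (e₂ i) (fun η => linStat φ η ^ 2) ξ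
      ≤ (1 - 2 * lam) * linStat φ ξ ^ 2
        + (Fintype.card ι : ℝ)⁻¹ * δ ^ 2 * 4 * ∑ v, (ξ v : ℝ) ^ 2 := by
    intro ξ
    have h := hφ (fun v => (ξ v : ℝ))
    calc _ ≤ (Fintype.card ι : ℝ)⁻¹ * ∑ i, (linStat φ ξ ^ 2 + 2 * linStat φ ξ
            * ((φ (e₁ i) - φ (e₂ i)) * (ξ (e₂ i) - ξ (e₁ i)) / 2)
            + δ ^ 2 * (2 * ((ξ (e₁ i) : ℝ) ^ 2 + ξ (e₂ i) ^ 2))) := by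
          refine mul_le_mul_of_nonneg_left (sum_le_sum fun i _ => ?_) hc
          refine (ringOp_linStat_sq_le hs φ (he i) ξ).trans (add_le_add_right ?_ _)
          exact mul_le_mul_of_nonneg_right (sq_le_sq' (abs_le.1 (hδ i)).1 (abs_le.1 (hδ i)).2)
            (by positivity)
      _ = (1 - 2 * lam) * linStat φ ξ ^ 2 + (Fintype.card ι : ℝ)⁻¹ * δ ^ 2 * 2
            * ∑ i, ((ξ (e₁ i) : ℝ) ^ 2 + ξ (e₂ i) ^ 2) := by
          rw [sum_add_distrib, sum_add_distrib, mul_add, mul_add, inv_card_mul_sum_const,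
            ← mul_sum, mul_left_comm, h, ← mul_sum, ← mul_sum]
          simp only [linStat]
          ring
      _ ≤ (1 - 2 * lam) * linStat φ ξ ^ 2 + (Fintype.card ι : ℝ)⁻¹ * δ ^ 2 * 2
            * (2 * ∑ v, (ξ v : ℝ) ^ 2) := by
          have := hdeg (fun v => (ξ v : ℝ))
          gcongr
      _ = _ := by ring
  refine (configSum_mono hμ.nonneg fun ξ _ => hpt ξ).trans ?_
  rw [configSum_add, configSum_const_mul, configSum_const_mul, configSum_sum]
  refine add_le_add_right (mul_le_mul_of_nonneg_left ?_ (by positivity)) _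
  calc ∑ v, configSum μ (fun ξ => (ξ v : ℝ) ^ 2) ≤ ∑ _v : V, (B + A * (s + 1)) := by
        refine sum_le_sum fun v _ => ?_
        have h1 : configSum μ (fun ξ => (ξ v : ℝ) ^ 2)
            = configSum μ (fun ξ => (ξ v : ℝ)) + configSum μ (pairCount v v) := by
          rw [← configSum_add]
          refine configSum_congr fun ξ _ => ?_
          simp only [pairCount, if_true]
          ring
        have h2 := hμ.pairCount_le v v
        rw [if_pos rfl] at h2
        rw [h1]
        exact add_le_add (hμ.apply_le v) h2
    _ = _ := by simp [mul_add]

end Step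

/-! ### Poissonization: the continuous-time law as a mixture of the discrete skeleton -/

section Poisson

variable {Ω : Type*} [Fintype Ω] [DecidableEq Ω]

lemma exp_smul_sub_one (P : Matrix Ω Ω ℝ) (t : ℝ) :
    NormedSpace.exp (t • (P - 1)) = Real.exp (-t) • NormedSpace.exp (t • P) := by
  have h : t • (P - 1) = (-t) • (1 : Matrix Ω Ω ℝ) + t • P := by
    rw [smul_sub, neg_smul, sub_eq_neg_add]
  have h1 : NormedSpace.exp ((-t) • (1 : Matrix Ω Ω ℝ)) = Real.exp (-t) • 1 := by
    rw [smul_one_eq_diagonal, Matrix.exp_diagonal, smul_one_eq_diagonal]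
    congr 1
    funext i
    rw [Pi.coe_exp, Real.exp_eq_exp_ℝ]
  rw [h, Matrix.exp_add_of_commute _ _ ((Commute.one_left _).smul_left _), h1, smul_mul_assoc,
    one_mul]

lemma hasSum_dotProduct_exp (P : Matrix Ω Ω ℝ) (t : ℝ) (μ f : Ω → ℝ) :
    HasSum (fun k : ℕ => Real.exp (-t) * (t ^ k / k.factorial) * ((μ ᵥ* P ^ k) ⬝ᵥ f))
      ((μ ᵥ* NormedSpace.exp (t • (P - 1))) ⬝ᵥ f) := by
  have h : HasSum (fun k : ℕ => ((k.factorial : ℝ)⁻¹) • (t • P) ^ k)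
      (NormedSpace.exp (t • P)) := by
    open scoped Norms.Operator in
    exact NormedSpace.exp_series_hasSum_exp' (𝕂 := ℝ) (t • P)
  let L : Matrix Ω Ω ℝ →ₗ[ℝ] ℝ :=
    { toFun := fun A => (μ ᵥ* A) ⬝ᵥ f
      map_add' := fun A B => by rw [vecMul_add, add_dotProduct]
      map_smul' := fun c A => by rw [vecMul_smul, smul_dotProduct]; rfl }
  have hL : Continuous L := LinearMap.continuous_of_finiteDimensional L
  have h2 := (h.map L hL).mul_left (Real.exp (-t))
  rw [exp_smul_sub_one]
  have h3 : (μ ᵥ* (Real.exp (-t) • NormedSpace.exp (t • P))) ⬝ᵥ f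
      = Real.exp (-t) * L (NormedSpace.exp (t • P)) := by
    rw [vecMul_smul, smul_dotProduct]
    rfl
  have h4 : (fun k : ℕ => Real.exp (-t) * (t ^ k / k.factorial) * ((μ ᵥ* P ^ k) ⬝ᵥ f))
      = fun k => Real.exp (-t) * (L ∘ fun k : ℕ => ((k.factorial : ℝ)⁻¹) • (t • P) ^ k) k := by
    funext k
    simp only [Function.comp, smul_pow, map_smul, smul_eq_mul]
    simp only [L, LinearMap.coe_mk, AddHom.coe_mk]
    ring
  rw [h3, h4]
  exact h2

/-- The Poisson generating function: geometric decay at rate `c` per step becomes `exp (-(1 - c) *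
t)`. -/
lemma hasSum_poisson_pow (t c : ℝ) :
    HasSum (fun k : ℕ => Real.exp (-t) * (t ^ k / k.factorial) * c ^ k)
      (Real.exp (-(1 - c) * t)) := by
  have h := (NormedSpace.expSeries_div_hasSum_exp (t * c)).mul_left (Real.exp (-t))
  rw [← Real.exp_eq_exp_ℝ, ← Real.exp_add] at h
  rw [show -(1 - c) * t = -t + t * c by ring]
  refine (congrArg (HasSum · _) (funext fun k => ?_)).mp h
  rw [mul_pow]
  ring

lemma dotProduct_exp_eq {P : Matrix Ω Ω ℝ} {t : ℝ} {μ f : Ω → ℝ} {a c : ℝ}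
    (h : ∀ k : ℕ, (μ ᵥ* P ^ k) ⬝ᵥ f = a * c ^ k) :
    (μ ᵥ* NormedSpace.exp (t • (P - 1))) ⬝ᵥ f = a * Real.exp (-(1 - c) * t) := by
  refine (hasSum_dotProduct_exp P t μ f).unique ?_
  refine (congrArg (HasSum · _) (funext fun k => ?_)).mp ((hasSum_poisson_pow t c).mul_left a)
  rw [h k]
  ring

lemma dotProduct_exp_le {P : Matrix Ω Ω ℝ} {t : ℝ} (ht : 0 ≤ t) {μ f : Ω → ℝ} {a b c : ℝ}
    (h : ∀ k : ℕ, (μ ᵥ* P ^ k) ⬝ᵥ f ≤ a * c ^ k + b) :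
    (μ ᵥ* NormedSpace.exp (t • (P - 1))) ⬝ᵥ f ≤ a * Real.exp (-(1 - c) * t) + b := by
  have h1 := ((hasSum_poisson_pow t c).mul_left a).add ((hasSum_poisson_pow t 1).mul_left b)
  simp only [sub_self, neg_zero, zero_mul, Real.exp_zero, mul_one, one_pow] at h1
  refine hasSum_le (fun k => ?_) (hasSum_dotProduct_exp P t μ f) h1
  have hw : 0 ≤ Real.exp (-t) * (t ^ k / k.factorial) := by positivity
  have := mul_le_mul_of_nonneg_left (h k) hw
  linarith

lemma vecMul_exp_nonneg {P : Matrix Ω Ω ℝ} {t : ℝ} (ht : 0 ≤ t) {μ : Ω → ℝ}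
    (h : ∀ k : ℕ, ∀ ω, 0 ≤ (μ ᵥ* P ^ k) ω) (ω : Ω) :
    0 ≤ (μ ᵥ* NormedSpace.exp (t • (P - 1))) ω := by
  have := (hasSum_dotProduct_exp P t μ (Pi.single ω 1)).nonneg fun k => by
    rw [dotProduct_single_one]
    have := h k ω
    positivity
  rwa [dotProduct_single_one] at this

/-! ### Lower bounds on the total variation distance -/

omit [DecidableEq Ω] in
lemma sum_sub_le_tvDist (μ ν : Ω → ℝ) (A : Finset Ω) : ∑ ω ∈ A, (μ ω - ν ω) ≤ tvDist μ ν :=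
  (sum_le_sum fun _ _ => le_max_left _ _).trans
    (sum_le_univ_sum_of_nonneg fun _ => le_max_right _ _)

/-- A bound uniform over deterministic starts passes to every random start `ν` by averaging; this
permits the multinomial initial law. -/
lemma sum_vecMul_exp_sub_le {Q : Matrix Ω Ω ℝ} {t ε : ℝ} {π ν : Ω → ℝ}
    (h : ∀ ω₀, tvDist (lawAt Q t ω₀) π ≤ ε) (hν : ∀ ω, 0 ≤ ν ω) (hν1 : ∑ ω, ν ω = 1)
    (A : Finset Ω) :
    ∑ ω ∈ A, ((ν ᵥ* NormedSpace.exp (t • Q)) ω - π ω) ≤ ε := by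
  calc _ = ∑ ω₀, ν ω₀ * ∑ ω ∈ A, (lawAt Q t ω₀ ω - π ω) := by
        simp only [mul_sum, mul_sub, sum_sub_distrib]
        rw [sum_comm, sum_comm (s := univ)]
        congr 1
        exact sum_congr rfl fun ω _ => by rw [← sum_mul, hν1, one_mul]
    _ ≤ ∑ ω₀, ν ω₀ * ε := sum_le_sum fun ω₀ _ =>
        mul_le_mul_of_nonneg_left ((sum_sub_le_tvDist _ _ A).trans (h ω₀)) (hν ω₀)
    _ = ε := by rw [← sum_mul, hν1, one_mul]

omit [DecidableEq Ω] in
/-- If `f` has `μ`-mean `M > 0`, and second moments about `M` under `μ` and about `0` under `π`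
that are small compared with `M ^ 2`, then `μ` and `π` are almost singular. -/
lemma le_sum_sub_of_moments {μ π f : Ω → ℝ} (hμ : ∀ ω, 0 ≤ μ ω) (hμ1 : ∑ ω, μ ω = 1)
    (hπ : ∀ ω, 0 ≤ π ω) {M : ℝ} (hM : 0 < M) (hf : μ ⬝ᵥ f = M) :
    1 - 4 * (μ ⬝ᵥ (fun ω => f ω ^ 2) - M ^ 2 + π ⬝ᵥ (fun ω => f ω ^ 2)) / M ^ 2
      ≤ ∑ ω ∈ univ.filter (fun ω => M / 2 ≤ f ω), (μ ω - π ω) := by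
  rw [sum_sub_distrib, sum_filter, sum_filter]
  have hM2 : 0 < M ^ 2 := by positivity
  -- Chebyshev as pointwise comparison: `1 - 4(f - M)²/M²` is at most the indicator of `M/2 ≤ f`,
  -- and in `h2` that indicator is at most `4f²/M²`.
  have h1 : ∑ ω, μ ω * (1 - 4 * (f ω - M) ^ 2 / M ^ 2)
      ≤ ∑ ω, if M / 2 ≤ f ω then μ ω else 0 := by
    refine sum_le_sum fun ω _ => ?_
    split_ifs with hc
    · refine mul_le_of_le_one_right (hμ ω) (sub_le_self _ (by positivity))
    · refine mul_nonpos_of_nonneg_of_nonpos (hμ ω) ?_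
      rw [sub_nonpos, le_div_iff₀ hM2]
      nlinarith [not_le.1 hc]
  have h2 : ∑ ω, (if M / 2 ≤ f ω then π ω else 0) ≤ ∑ ω, π ω * (4 * f ω ^ 2 / M ^ 2) := by
    refine sum_le_sum fun ω _ => ?_
    split_ifs with hc
    · refine le_mul_of_one_le_right (hπ ω) ?_
      rw [le_div_iff₀ hM2]
      nlinarith
    · exact mul_nonneg (hπ ω) (by positivity)
  have h3 : ∑ ω, μ ω * (1 - 4 * (f ω - M) ^ 2 / M ^ 2)
      = 1 - 4 * (μ ⬝ᵥ (fun ω => f ω ^ 2) - M ^ 2) / M ^ 2 := by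
    have : ∀ ω, μ ω * (1 - 4 * (f ω - M) ^ 2 / M ^ 2)
        = μ ω * (1 - 4) - 4 / M ^ 2 * (μ ω * f ω ^ 2) + 8 / M * (μ ω * f ω) := by
      intro ω
      field_simp
      ring
    simp only [this, sum_add_distrib, sum_sub_distrib, ← sum_mul, ← mul_sum, hμ1]
    change 1 * (1 - 4) - 4 / M ^ 2 * (μ ⬝ᵥ fun ω => f ω ^ 2) + 8 / M * (μ ⬝ᵥ f) = _
    rw [hf]
    field_simp
    ring
  have h4 : ∑ ω, π ω * (4 * f ω ^ 2 / M ^ 2) = 4 * (π ⬝ᵥ (fun ω => f ω ^ 2)) / M ^ 2 := by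
    simp only [dotProduct, mul_sum, sum_div]
    exact sum_congr rfl fun ω _ => by ring
  rw [h3] at h1
  rw [h4] at h2
  have : 1 - 4 * (μ ⬝ᵥ (fun ω => f ω ^ 2) - M ^ 2 + π ⬝ᵥ (fun ω => f ω ^ 2)) / M ^ 2
      = 1 - 4 * (μ ⬝ᵥ (fun ω => f ω ^ 2) - M ^ 2) / M ^ 2
        - 4 * (π ⬝ᵥ (fun ω => f ω ^ 2)) / M ^ 2 := by ring
  rw [this]
  exact sub_le_sub h1 h2

end Poisson

/-! ### The multinomial distribution -/

section Multinomial

variable {V : Type*} [Fintype V] [DecidableEq V] {m : ℕ}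

/-- The configuration in which particle `i` sits on the vertex `g i`. -/
def countConfig (g : Fin m → V) : Config V m :=
  ⟨fun v => #{i | g i = v}, by
    rw [← card_eq_sum_card_fiberwise (fun i _ => by simp)]
    simp⟩

lemma countConfig_apply (g : Fin m → V) (v : V) :
    (((countConfig g).1 v : ℕ) : ℝ) = ∑ i, if g i = v then 1 else 0 := by
  simp [countConfig]

/-- The law of the configuration of `m` independent particles with law `p`. -/
def multinomial (p : V → ℝ) (m : ℕ) (ξ : Config V m) : ℝ :=
  ∑ g : Fin m → V, if countConfig g = ξ then ∏ i, p (g i) else 0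

lemma configSum_multinomial (p : V → ℝ) (f : (V → ℕ) → ℝ) :
    configSum (multinomial p m) f = ∑ g : Fin m → V, (∏ i, p (g i)) * f (countConfig g).1 := by
  simp only [configSum, multinomial, sum_mul, ite_mul, zero_mul]
  rw [sum_comm]
  simp

omit [DecidableEq V] in
lemma sum_prod_mul_prod (p : V → ℝ) (h : Fin m → V → ℝ) :
    ∑ g : Fin m → V, (∏ i, p (g i)) * ∏ i, h i (g i) = ∏ i, ∑ v, p v * h i v := by
  rw [prod_univ_sum, Fintype.piFinset_univ]
  simp only [prod_mul_distrib]

omit [DecidableEq V] in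
lemma sum_prod_mul_apply {p : V → ℝ} (hp : ∑ v, p v = 1) (h : V → ℝ) (i : Fin m) :
    ∑ g : Fin m → V, (∏ k, p (g k)) * h (g i) = ∑ v, p v * h v := by
  have h1 := sum_prod_mul_prod p (fun k v => if k = i then h v else 1)
  simp only [prod_ite_eq', mem_univ, if_true] at h1
  rw [h1, prod_eq_single i]
  · simp
  · intro k _ hk
    simp [hk, hp]
  · simp

omit [DecidableEq V] in
lemma sum_prod_mul_apply_mul_apply {p : V → ℝ} (hp : ∑ v, p v = 1) (h₁ h₂ : V → ℝ)
    {i j : Fin m} (hij : i ≠ j) :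
    ∑ g : Fin m → V, (∏ k, p (g k)) * (h₁ (g i) * h₂ (g j))
      = (∑ v, p v * h₁ v) * ∑ v, p v * h₂ v := by
  have h3 := sum_prod_mul_prod p
    (fun k v => (if k = i then h₁ v else 1) * (if k = j then h₂ v else 1))
  simp only [prod_mul_distrib, prod_ite_eq', mem_univ, if_true] at h3
  rw [h3, prod_eq_mul i j hij]
  · simp [hij, hij.symm]
  · intro k _ hk
    simp [hk.1, hk.2, hp]
  · simp
  · simp

lemma configSum_multinomial_apply {p : V → ℝ} (hp : ∑ v, p v = 1) (a : V) :
    configSum (multinomial p m) (fun ξ => (ξ a : ℝ)) = m * p a := by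
  rw [configSum_multinomial]
  simp only [countConfig_apply, mul_sum]
  rw [sum_comm]
  simp only [fun i : Fin m => sum_prod_mul_apply hp (fun v => if v = a then 1 else 0) i]
  simp

/-- Pair counts run over distinct particles, so independence factorizes their means with no diagonal
correction. -/
lemma pairCount_countConfig (a b : V) (g : Fin m → V) :
    pairCount a b (countConfig g).1
      = ∑ i, ∑ j ∈ univ.erase i, (if g i = a then 1 else 0) * (if g j = b then 1 else 0) := by
  have h : ∀ i, ∑ j ∈ univ.erase i, ((if g i = a then 1 else 0) * (if g j = b then 1 else 0) : ℝ)
      = (if g i = a then 1 else 0) * ((countConfig g).1 b : ℝ)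
        - (if g i = a then 1 else 0) * (if a = b then 1 else 0) := by
    intro i
    rw [← mul_sum, sum_erase_eq_sub (mem_univ i), mul_sub, ← countConfig_apply]
    congr 1
    by_cases hi : g i = a <;> simp [hi]
  simp only [h, sum_sub_distrib, ← sum_mul, ← countConfig_apply]
  rw [pairCount, mul_sub]

lemma configSum_multinomial_pairCount {p : V → ℝ} (hp : ∑ v, p v = 1) (a b : V) :
    configSum (multinomial p m) (pairCount a b) = m * (m - 1) * (p a * p b) := by
  rw [configSum_multinomial]
  simp only [pairCount_countConfig, mul_sum]
  rw [sum_comm]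
  have h : ∀ i : Fin m, ∑ g : Fin m → V, ∑ j ∈ univ.erase i, (∏ k, p (g k))
      * ((if g i = a then 1 else 0) * (if g j = b then 1 else 0)) = (m - 1) * (p a * p b) := by
    intro i
    rw [sum_comm]
    have hm : 1 ≤ m := (Nat.zero_le _).trans_lt i.2
    rw [sum_congr rfl (g := fun _ => p a * p b) fun j hj => ?_]
    · simp [Nat.cast_sub hm]
    · have := sum_prod_mul_apply_mul_apply hp (fun v => if v = a then 1 else 0)
        (fun v => if v = b then 1 else 0) (ne_of_mem_erase hj).symm
      rw [this]
      simp
  simp only [h]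
  simp
  ring

lemma multinomial_nonneg {p : V → ℝ} (hp : ∀ v, 0 ≤ p v) (ξ : Config V m) :
    0 ≤ multinomial p m ξ :=
  sum_nonneg fun g _ => by
    split_ifs
    exacts [prod_nonneg fun i _ => hp (g i), le_rfl]

lemma sum_multinomial {p : V → ℝ} (hp : ∑ v, p v = 1) : ∑ ξ, multinomial p m ξ = 1 := by
  have h := configSum_multinomial (m := m) p (fun _ => 1)
  have h1 := sum_prod_mul_prod (m := m) p (fun _ _ => 1)
  simp only [configSum, mul_one, prod_const_one, hp] at h h1
  rw [h, h1]

/-- The constant `A = (mβ)²/s` is chosen so that already the off-diagonal value `A * s` dominates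
every pair mean. -/
lemma momentBound_multinomial {s : ℝ} (hs : 0 < s) {p : V → ℝ} (hp0 : ∀ v, 0 ≤ p v)
    (hp : ∑ v, p v = 1) {β : ℝ} (hβ : ∀ v, p v ≤ β) :
    MomentBound s ((m * β) ^ 2 / s) (m * β) (multinomial p m) where
  nonneg := multinomial_nonneg hp0
  sum_eq_one := sum_multinomial hp
  apply_le a := by
    rw [configSum_multinomial_apply hp]
    have := hβ a
    gcongr
  pairCount_le a b := by
    rw [configSum_multinomial_pairCount hp]
    have hβ0 : 0 ≤ β := (hp0 a).trans (hβ a)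
    calc (m : ℝ) * (m - 1) * (p a * p b) ≤ m ^ 2 * (β * β) := by
          refine mul_le_mul ?_ (mul_le_mul (hβ a) (hβ b) (hp0 b) hβ0)
            (mul_nonneg (hp0 a) (hp0 b)) (by positivity)
          nlinarith [(Nat.cast_nonneg m : (0 : ℝ) ≤ m)]
      _ = (m * β) ^ 2 / s * s := by field_simp
      _ ≤ _ := by
        refine mul_le_mul_of_nonneg_left ?_ (by positivity)
        split_ifs <;> linarith

lemma configSum_multinomial_linStat {p : V → ℝ} (hp : ∑ v, p v = 1) (φ : V → ℝ) :
    configSum (multinomial p m) (linStat φ) = m * ∑ v, φ v * p v := by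
  rw [configSum_linStat, mul_sum]
  refine sum_congr rfl fun a _ => ?_
  rw [configSum_multinomial_apply hp]
  ring

lemma configSum_multinomial_linStat_sq_le {p : V → ℝ} (hp0 : ∀ v, 0 ≤ p v) (hp : ∑ v, p v = 1)
    {φ : V → ℝ} (hφ : ∀ v, |φ v| ≤ 1) :
    configSum (multinomial p m) (fun ξ => linStat φ ξ ^ 2)
      ≤ (m * ∑ v, φ v * p v) ^ 2 + m := by
  rw [configSum_linStat_sq]
  simp only [configSum_multinomial_apply hp, configSum_multinomial_pairCount hp]
  have h1 : ∑ a, ∑ b, φ a * φ b * (m * (m - 1) * (p a * p b))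
      = m * (m - 1) * (∑ v, φ v * p v) ^ 2 := by
    rw [sq, sum_mul_sum, mul_sum]
    refine sum_congr rfl fun a _ => ?_
    rw [mul_sum]
    exact sum_congr rfl fun b _ => by ring
  have h2 : ∑ a, φ a ^ 2 * (m * p a) ≤ m := by
    calc _ ≤ ∑ a, (m : ℝ) * p a := sum_le_sum fun a _ =>
          mul_le_of_le_one_left (mul_nonneg (Nat.cast_nonneg m) (hp0 a))
            ((sq_le_one_iff_abs_le_one _).2 (hφ a))
      _ = m := by rw [← mul_sum, hp, mul_one]
  rw [h1]
  refine add_le_add ?_ h2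
  rw [mul_pow]
  refine mul_le_mul_of_nonneg_right ?_ (sq_nonneg _)
  nlinarith [(Nat.cast_nonneg m : (0 : ℝ) ≤ m)]

end Multinomial

/-! ### The path graph -/

section Path

lemma sum_edgeFinset_pathGraph (N : ℕ) [Fintype (SimpleGraph.pathGraph (N + 1)).edgeSet]
    (f : Sym2 (Fin (N + 1)) → ℝ) :
    ∑ e ∈ (SimpleGraph.pathGraph (N + 1)).edgeFinset, f e
      = ∑ k : Fin N, f s(k.castSucc, k.succ) := by
  symm
  refine sum_bij (fun k _ => s(k.castSucc, k.succ)) ?_ ?_ ?_ (fun _ _ => rfl)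
  · intro k _
    simp [SimpleGraph.pathGraph_adj]
  · intro k _ l _ h
    rw [Sym2.eq_iff] at h
    simp only [Fin.ext_iff, Fin.val_castSucc, Fin.val_succ] at h
    exact Fin.ext (by omega)
  · intro e he
    induction e using Sym2.ind with
    | _ u v =>
      rw [SimpleGraph.mem_edgeFinset, SimpleGraph.mem_edgeSet, SimpleGraph.pathGraph_adj] at he
      rcases he with he | he
      · refine ⟨⟨u, by omega⟩, mem_univ _, ?_⟩
        rw [Sym2.eq_iff]
        exact Or.inl ⟨Fin.ext rfl, Fin.ext he⟩
      · refine ⟨⟨v, by omega⟩, mem_univ _, ?_⟩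
        rw [Sym2.eq_iff]
        exact Or.inr ⟨Fin.ext rfl, Fin.ext he⟩

lemma generatorBB_pathGraph {N : ℕ} (hN : 0 < N) (s : ℝ) (m : ℕ) :
    generatorBB (SimpleGraph.pathGraph (N + 1)) (fun _ => 1) s m
      = stepMatrix s m (Fin.castSucc : Fin N → Fin (N + 1)) Fin.succ - 1 := by
  have hN' : (N : ℝ) ≠ 0 := by positivity
  funext ξ ξ'
  simp only [generatorBB, sum_edgeFinset_pathGraph]
  simp only [Matrix.sub_apply, stepMatrix, Matrix.smul_apply, Matrix.sum_apply, ringMatrix,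
    Matrix.one_apply, Sym2.inf_mk, Sym2.sup_mk, smul_eq_mul, Fintype.card_fin, sum_const, card_univ,
    nsmul_eq_mul, mul_one, ← mul_sum, sum_sub_distrib]
  have h1 : ∀ k : Fin N, k.castSucc ⊓ k.succ = k.castSucc := fun k =>
    inf_eq_left.2 Fin.castSucc_lt_succ.le
  have h2 : ∀ k : Fin N, k.castSucc ⊔ k.succ = k.succ := fun k =>
    sup_eq_right.2 Fin.castSucc_lt_succ.le
  simp only [h1, h2]
  rw [mul_sub, one_div, inv_mul_cancel_left₀ hN']

/-- The first nonconstant Neumann eigenfunction of the path on `N + 1` vertices. -/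
noncomputable def cosWave (N : ℕ) (k : Fin (N + 1)) : ℝ :=
  Real.cos ((k + 1 / 2) * (Real.pi / (N + 1)))

/-- Minus the discrete gradient of `cosWave`, shifted by one. -/
noncomputable def sinWave (N : ℕ) (k : ℕ) : ℝ :=
  2 * Real.sin (k * (Real.pi / (N + 1))) * Real.sin (Real.pi / (N + 1) / 2)

variable (N : ℕ)

lemma abs_cosWave_le_one (k : Fin (N + 1)) : |cosWave N k| ≤ 1 := Real.abs_cos_le_one _

lemma cosWave_sub (k : Fin N) :
    cosWave N k.castSucc - cosWave N k.succ = sinWave N (k + 1) := by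
  unfold cosWave sinWave
  rw [Real.cos_sub_cos, Fin.val_castSucc, Fin.val_succ]
  set θ := Real.pi / (N + 1)
  rw [show ((((k : ℕ) : ℝ) + 1 / 2) * θ + (((k + 1 : ℕ) : ℝ) + 1 / 2) * θ) / 2
    = ((k + 1 : ℕ) : ℝ) * θ by push_cast; ring,
    show ((((k : ℕ) : ℝ) + 1 / 2) * θ - (((k + 1 : ℕ) : ℝ) + 1 / 2) * θ) / 2 = -(θ / 2) by
      push_cast; ring, Real.sin_neg]
  ring

lemma sinWave_sub (k : Fin (N + 1)) :
    sinWave N (k + 1) - sinWave N k = 2 * (1 - Real.cos (Real.pi / (N + 1))) * cosWave N k := by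
  unfold cosWave sinWave
  set θ := Real.pi / (N + 1)
  rw [← sub_mul, ← mul_sub, Real.sin_sub_sin,
    show (((k + 1 : ℕ) : ℝ) * θ - ((k : ℕ) : ℝ) * θ) / 2 = θ / 2 by push_cast; ring,
    show (((k + 1 : ℕ) : ℝ) * θ + ((k : ℕ) : ℝ) * θ) / 2 = (((k : ℕ) : ℝ) + 1 / 2) * θ by
      push_cast; ring]
  have h : Real.cos θ = 1 - 2 * Real.sin (θ / 2) ^ 2 := by
    have h1 := Real.cos_two_mul' (θ / 2)
    have h2 := Real.sin_sq_add_cos_sq (θ / 2)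
    rw [show 2 * (θ / 2) = θ by ring] at h1
    linarith
  rw [h]
  ring

lemma sinWave_zero : sinWave N 0 = 0 := by simp [sinWave]

lemma sinWave_last : sinWave N (N + 1) = 0 := by
  have : ((N + 1 : ℕ) : ℝ) * (Real.pi / (N + 1)) = Real.pi := by push_cast; field_simp
  rw [sinWave, this]
  simp

/-- Summation by parts: the gradient of the cosine is a sine wave vanishing at `0` and `N + 1`, so
there are no boundary terms, and the gradient of the sine wave returns the cosine. -/
lemma isEdgeEigenfunction_cosWave :
    IsEdgeEigenfunction (Fin.castSucc : Fin N → Fin (N + 1)) Fin.succ (cosWave N)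
      ((1 - Real.cos (Real.pi / (N + 1))) / N) := by
  intro x
  have h1 := Fin.sum_univ_succ (fun j : Fin (N + 1) => sinWave N j * x j)
  have h2 := Fin.sum_univ_castSucc (fun j : Fin (N + 1) => sinWave N (j + 1) * x j)
  simp only [Fin.val_zero, Fin.val_succ, Fin.val_castSucc, Fin.val_last, sinWave_zero,
    sinWave_last, zero_mul, zero_add, add_zero] at h1 h2
  have h3 : ∑ i : Fin N, (cosWave N i.castSucc - cosWave N i.succ) * (x i.succ - x i.castSucc) / 2
      = -(1 - Real.cos (Real.pi / (N + 1))) * ∑ v, cosWave N v * x v := by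
    simp only [cosWave_sub, mul_sub]
    rw [← sum_div, sum_sub_distrib, ← h1, ← h2, ← sum_sub_distrib, mul_sum, sum_div]
    refine sum_congr rfl fun k _ => ?_
    have := sinWave_sub N k
    rw [← sub_mul, ← neg_sub, this]
    ring
  rw [h3, Fintype.card_fin]
  ring

lemma abs_cosWave_sub_le (k : Fin N) :
    |cosWave N k.castSucc - cosWave N k.succ| ≤ Real.pi / (N + 1) := by
  rw [cosWave_sub, sinWave, abs_mul, abs_mul, abs_two]
  have hθ : 0 ≤ Real.pi / (N + 1) / 2 := by positivity
  calc _ ≤ 2 * 1 * (Real.pi / (N + 1) / 2) := by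
        gcongr
        · exact Real.abs_sin_le_one _
        · exact (Real.abs_sin_le_abs).trans (abs_of_nonneg hθ).le
    _ = _ := by ring

variable {N}

lemma pi_div_mem_Ioo (hN : 0 < N) : Real.pi / (N + 1) ∈ Set.Ioo 0 Real.pi := by
  refine ⟨by positivity, div_lt_self Real.pi_pos ?_⟩
  have : (0 : ℝ) < N := by exact_mod_cast hN
  linarith

lemma cos_pi_div_lt_one (hN : 0 < N) : Real.cos (Real.pi / (N + 1)) < 1 := by
  obtain ⟨h0, h1⟩ := pi_div_mem_Ioo hN
  have := Real.cos_lt_cos_of_nonneg_of_le_pi le_rfl h1.le h0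
  rwa [Real.cos_zero] at this

lemma sum_cosWave (hN : 0 < N) : ∑ k, cosWave N k = 0 := by
  have h : ∑ k : Fin (N + 1), (sinWave N (k + 1) - sinWave N k) = 0 := by
    rw [Fin.sum_univ_eq_sum_range (fun k => sinWave N (k + 1) - sinWave N k),
      sum_range_sub, sinWave_zero, sinWave_last, sub_zero]
  simp only [sinWave_sub, ← mul_sum] at h
  refine (mul_eq_zero.1 h).resolve_left ?_
  have := cos_pi_div_lt_one hN
  linarith

/-- In `cos² = 1/2 + cos(2·)/2` the second part telescopes after multiplication by `sin θ`, and the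
end values `sin 0` and `sin 2π` vanish. -/
lemma sum_cosWave_sq (hN : 0 < N) : ∑ k, cosWave N k ^ 2 = ((N : ℝ) + 1) / 2 := by
  set θ := Real.pi / (N + 1) with hθ
  obtain ⟨h0, h1⟩ := pi_div_mem_Ioo hN
  have hs : 0 < Real.sin θ := Real.sin_pos_of_pos_of_lt_pi h0 h1
  have hterm : ∀ k : Fin (N + 1), cosWave N k ^ 2 = 1 / 2
      + (Real.sin (2 * ((k + 1 : ℕ) : ℝ) * θ) - Real.sin (2 * ((k : ℕ) : ℝ) * θ))
        / (4 * Real.sin θ) := by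
    intro k
    rw [cosWave, ← hθ, Real.cos_sq, Real.sin_sub_sin,
      show (2 * ((k + 1 : ℕ) : ℝ) * θ - 2 * ((k : ℕ) : ℝ) * θ) / 2 = θ by push_cast; ring,
      show (2 * ((k + 1 : ℕ) : ℝ) * θ + 2 * ((k : ℕ) : ℝ) * θ) / 2
        = 2 * ((((k : ℕ) : ℝ) + 1 / 2) * θ) by push_cast; ring]
    field_simp
    ring
  simp only [hterm, sum_add_distrib, ← sum_div]
  rw [Fin.sum_univ_eq_sum_range
    (fun k : ℕ => Real.sin (2 * ((k + 1 : ℕ) : ℝ) * θ) - Real.sin (2 * ((k : ℕ) : ℝ) * θ)),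
    sum_range_sub (fun k : ℕ => Real.sin (2 * (k : ℝ) * θ))]
  have : 2 * ((N + 1 : ℕ) : ℝ) * θ = 2 * Real.pi := by
    rw [hθ]; push_cast; field_simp
  rw [this]
  simp

lemma sum_sq_add_sq_le (x : Fin (N + 1) → ℝ) :
    ∑ i : Fin N, (x i.castSucc ^ 2 + x i.succ ^ 2) ≤ 2 * ∑ v, x v ^ 2 := by
  rw [sum_add_distrib, two_mul]
  refine add_le_add ?_ ?_
  · rw [Fin.sum_univ_castSucc (fun v => x v ^ 2)]
    linarith [sq_nonneg (x (Fin.last N))]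
  · rw [Fin.sum_univ_succ (fun v => x v ^ 2)]
    linarith [sq_nonneg (x 0)]

end Path

/-! ### The lower bound on the mixing time -/

/-- The law of a particle that tilts the uniform distribution on the path by `cosWave`. -/
noncomputable def tiltedLaw (N : ℕ) (k : Fin (N + 1)) : ℝ := (1 + cosWave N k) / (N + 1)

lemma tiltedLaw_nonneg (N : ℕ) (k : Fin (N + 1)) : 0 ≤ tiltedLaw N k :=
  div_nonneg (by linarith [(abs_le.1 (abs_cosWave_le_one N k)).1]) (by positivity)

/-- A density bounded by twice the uniform one keeps the initial pair means of order `(m/n)²`. -/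
lemma tiltedLaw_le (N : ℕ) (k : Fin (N + 1)) : tiltedLaw N k ≤ 2 / (N + 1) :=
  div_le_div_of_nonneg_right (by linarith [(abs_le.1 (abs_cosWave_le_one N k)).2])
    (by positivity)

lemma sum_tiltedLaw {N : ℕ} (hN : 0 < N) : ∑ k, tiltedLaw N k = 1 := by
  simp only [tiltedLaw, ← sum_div, sum_add_distrib, sum_cosWave hN]
  have : (N : ℝ) + 1 ≠ 0 := by positivity
  simp [this]

lemma sum_cosWave_mul_tiltedLaw {N : ℕ} (hN : 0 < N) :
    ∑ k, cosWave N k * tiltedLaw N k = 1 / 2 := by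
  have h : ∀ k, cosWave N k * tiltedLaw N k = (cosWave N k + cosWave N k ^ 2) / (N + 1) := by
    intro k
    rw [tiltedLaw]
    ring
  simp only [h, ← sum_div, sum_add_distrib, sum_cosWave hN, sum_cosWave_sq hN]
  field_simp
  ring

lemma le_pow_mul_add_of_succ_le {q : ℕ → ℝ} {lam K : ℝ} (hlam : 0 < lam) (hlam' : 2 * lam ≤ 1)
    (h : ∀ k, q (k + 1) ≤ (1 - 2 * lam) * q k + K) (hK : 0 ≤ K) (k : ℕ) :
    q k ≤ q 0 * (1 - 2 * lam) ^ k + K / (2 * lam) := by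
  induction k with
  | zero =>
    have : 0 ≤ K / (2 * lam) := by positivity
    simpa using this
  | succ k ih =>
    have h1 := mul_le_mul_of_nonneg_left ih (sub_nonneg.2 hlam')
    have h2 : (1 - 2 * lam) * (K / (2 * lam)) + K = K / (2 * lam) := by
      field_simp
      ring
    calc q (k + 1) ≤ (1 - 2 * lam) * q k + K := h k
      _ ≤ (1 - 2 * lam) * (q 0 * (1 - 2 * lam) ^ k + K / (2 * lam)) + K := by linarith
      _ = q 0 * (1 - 2 * lam) ^ (k + 1) + ((1 - 2 * lam) * (K / (2 * lam)) + K) := by ring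
      _ = _ := by rw [h2]

lemma le_of_tvDist_le {N m : ℕ} {s t ε : ℝ} (hN : 3 ≤ N) (hm : 0 < m) (hs : 0 < s) (ht : 0 ≤ t)
    (h : ∀ ω₀, tvDist (lawAt (generatorBB (SimpleGraph.pathGraph (N + 1)) (fun _ => 1) s m) t ω₀)
      (equilibriumBB (Fin (N + 1)) s m) ≤ ε) {lam K : ℝ}
    (hlam : lam = (1 - Real.cos (Real.pi / (N + 1))) / N)
    (hK : K = (N : ℝ)⁻¹ * (Real.pi / (N + 1)) ^ 2 * 4
      * ((N + 1) * (m * (2 / (N + 1)) + (m * (2 / (N + 1))) ^ 2 / s * (s + 1)))) :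
    1 - 4 * (m + K / (2 * lam) + ((m : ℝ) ^ 2 / ((N + 1) * s) + m))
      / ((m / 2) ^ 2 * Real.exp (-(2 * lam) * t)) ≤ ε := by
  have hN0 : 0 < N := by omega
  have hNR : (3 : ℝ) ≤ N := by exact_mod_cast hN
  have : Nonempty (Fin N) := ⟨⟨0, hN0⟩⟩
  obtain ⟨hθ0, hθ1⟩ := pi_div_mem_Ioo hN0
  have hcos := cos_pi_div_lt_one hN0
  have hcos0 : 0 ≤ Real.cos (Real.pi / (N + 1)) := by
    refine Real.cos_nonneg_of_mem_Icc ⟨by linarith [Real.pi_pos], ?_⟩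
    exact div_le_div_of_nonneg_left Real.pi_pos.le two_pos (by linarith)
  have hlam0 : 0 < lam := by
    rw [hlam]
    exact div_pos (by linarith) (by linarith)
  -- Needed for `1 - 2 * lam ≥ 0`, so that the second-moment recursion can be iterated.
  have hlam1 : 2 * lam ≤ 1 := by
    rw [hlam, mul_div_assoc', div_le_one (by linarith)]
    linarith
  have hK0 : 0 ≤ K := by rw [hK]; positivity
  rw [generatorBB_pathGraph hN0] at h
  set P := stepMatrix s m (Fin.castSucc : Fin N → Fin (N + 1)) Fin.succ
  set ν := multinomial (tiltedLaw N) m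
  set φ := cosWave N
  have he : ∀ i : Fin N, i.castSucc ≠ i.succ := fun i => Fin.castSucc_lt_succ.ne
  have hφ := isEdgeEigenfunction_cosWave N
  rw [← hlam] at hφ
  have hν := momentBound_multinomial (m := m) hs (tiltedLaw_nonneg N) (sum_tiltedLaw hN0)
    (tiltedLaw_le N)
  have hpow : ∀ k : ℕ, ν ᵥ* P ^ (k + 1) = (ν ᵥ* P ^ k) ᵥ* P := fun k => by
    rw [pow_succ, vecMul_vecMul]
  have hbound : ∀ k : ℕ, MomentBound s ((m * (2 / (N + 1))) ^ 2 / s) (m * (2 / (N + 1)))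
      (ν ᵥ* P ^ k) := by
    intro k
    induction k with
    | zero => rw [pow_zero, vecMul_one]; exact hν
    | succ k ih => rw [hpow]; exact ih.vecMul_stepMatrix hs he
  have hmean0 : configSum ν (linStat φ) = m / 2 := by
    rw [configSum_multinomial_linStat (sum_tiltedLaw hN0), sum_cosWave_mul_tiltedLaw hN0]
    ring
  have hmean : ∀ k : ℕ, configSum (ν ᵥ* P ^ k) (linStat φ) = m / 2 * (1 - lam) ^ k := by
    intro k
    induction k with
    | zero => rw [pow_zero, vecMul_one, hmean0]; simp
    | succ k ih =>
      rw [hpow, configSum_vecMul_stepMatrix_linStat hs he hφ, ih]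
      ring
  have hsq : ∀ k : ℕ, configSum (ν ᵥ* P ^ k) (fun ξ => linStat φ ξ ^ 2)
      ≤ configSum ν (fun ξ => linStat φ ξ ^ 2) * (1 - 2 * lam) ^ k + K / (2 * lam) := by
    have := le_pow_mul_add_of_succ_le (K := K) hlam0 hlam1
      (q := fun k => configSum (ν ᵥ* P ^ k) (fun ξ => linStat φ ξ ^ 2)) (fun k => by
        have := (hbound k).configSum_linStat_sq_vecMul_le hs he hφ (abs_cosWave_sub_le N)
          sum_sq_add_sq_le
        simp only [hpow]
        refine this.trans (le_of_eq ?_)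
        rw [hK, Fintype.card_fin, Fintype.card_fin]
        push_cast
        rfl) hK0
    simpa using this
  set μ := ν ᵥ* NormedSpace.exp (t • (P - 1))
  set F : Config (Fin (N + 1)) m → ℝ := fun ξ => linStat φ ξ.1
  have hμF : μ ⬝ᵥ F = m / 2 * Real.exp (-lam * t) := by
    have := dotProduct_exp_eq (t := t) (μ := ν) (P := P) (f := F) hmean
    rwa [show -(1 - (1 - lam)) * t = -lam * t by ring] at this
  have hμF2 : μ ⬝ᵥ (fun ω => F ω ^ 2)
      ≤ configSum ν (fun ξ => linStat φ ξ ^ 2) * Real.exp (-(2 * lam) * t) + K / (2 * lam) := by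
    have := dotProduct_exp_le ht (μ := ν) (P := P) (f := fun ω => F ω ^ 2) hsq
    rwa [show -(1 - (1 - 2 * lam)) * t = -(2 * lam) * t by ring] at this
  have hμ0 : ∀ ω, 0 ≤ μ ω := vecMul_exp_nonneg ht fun k => (hbound k).nonneg
  have hμ1 : ∑ ω, μ ω = 1 := by
    have := dotProduct_exp_eq (t := t) (μ := ν) (P := P) (f := 1) (a := 1) (c := 1) fun k => by
      rw [dotProduct_one, (hbound k).sum_eq_one]
      simp
    rw [dotProduct_one] at this
    rw [this]
    simp
  have hm' : (0 : ℝ) < m := by exact_mod_cast hm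
  have hM : 0 < m / 2 * Real.exp (-lam * t) := by positivity
  have hMsq : (m / 2 * Real.exp (-lam * t)) ^ 2 = (m / 2) ^ 2 * Real.exp (-(2 * lam) * t) := by
    rw [mul_pow, ← Real.exp_nat_mul]
    congr 2
    push_cast
    ring
  have key := (le_sum_sub_of_moments hμ0 hμ1 (equilibriumBB_nonneg hs) hM hμF).trans
    (sum_vecMul_exp_sub_le h hν.nonneg hν.sum_eq_one _)
  refine le_trans ?_ key
  rw [hMsq]
  have hπ := configSum_equilibriumBB_linStat_sq_le (m := m) hs (abs_cosWave_le_one N)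
    (sum_cosWave hN0)
  rw [Fintype.card_fin] at hπ
  push_cast at hπ
  have hν2 := configSum_multinomial_linStat_sq_le (m := m) (tiltedLaw_nonneg N)
    (sum_tiltedLaw hN0) (abs_cosWave_le_one N)
  rw [sum_cosWave_mul_tiltedLaw hN0, mul_one_div] at hν2
  have hexp : Real.exp (-(2 * lam) * t) ≤ 1 := Real.exp_le_one_iff.2 (by nlinarith)
  have hexp0 := Real.exp_pos (-(2 * lam) * t)
  refine sub_le_sub_left (div_le_div_of_nonneg_right ?_ (by positivity)) _
  -- The initial second moment is at most `(m/2)² + m`. Its main part decays exactly as the squared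
  -- mean and will cancel against it, leaving only noise.
  have hv : configSum ν (fun ξ => linStat φ ξ ^ 2) * Real.exp (-(2 * lam) * t)
      ≤ (m / 2) ^ 2 * Real.exp (-(2 * lam) * t) + m := by
    have h1 := mul_le_mul_of_nonneg_right hν2 hexp0.le
    have h2 := mul_le_of_le_one_right hm'.le hexp
    calc _ ≤ _ := h1
      _ ≤ _ := by rw [add_mul]; exact add_le_add_right h2 _
  change configSum (equilibriumBB (Fin (N + 1)) s m) (fun ξ => linStat φ ξ ^ 2) ≤ _ at hπ
  have hπ' : equilibriumBB (Fin (N + 1)) s m ⬝ᵥ (fun ω => F ω ^ 2)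
      ≤ (m : ℝ) ^ 2 / ((N + 1) * s) + m := hπ
  linarith

lemma noise_le {N m : ℕ} {s lam K : ℝ} (hN : 3 ≤ N) (hm : 0 < m) (hs : 0 < s)
    (hlam : lam = (1 - Real.cos (Real.pi / (N + 1))) / N)
    (hK : K = (N : ℝ)⁻¹ * (Real.pi / (N + 1)) ^ 2 * 4
      * ((N + 1) * (m * (2 / (N + 1)) + (m * (2 / (N + 1))) ^ 2 / s * (s + 1)))) :
    m + K / (2 * lam) + ((m : ℝ) ^ 2 / ((N + 1) * s) + m)
      ≤ 42 * ((m : ℝ) ^ 2 / (N + 1) * (1 + (N + 1) / m + 1 / s)) := by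
  have hN0 : (0 : ℝ) < N := by exact_mod_cast (by omega : 0 < N)
  have hm' : (0 : ℝ) < m := by exact_mod_cast hm
  obtain ⟨hθ0, hθ1⟩ := pi_div_mem_Ioo (show 0 < N by omega)
  have hpi := Real.pi_pos
  -- From `cos x ≤ 1 - 2x²/π²` on `[-π, π]`: a lower bound on `lam` of the right order is enough
  -- here, since it affects only the constant.
  have hlow : 4 * (Real.pi / (N + 1)) ^ 2 / Real.pi ^ 2 / N ≤ 2 * lam := by
    have h := Real.cos_le_one_sub_mul_cos_sq (x := Real.pi / (N + 1))
      (by rw [abs_of_pos hθ0]; exact hθ1.le)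
    rw [hlam, mul_div_assoc']
    refine div_le_div_of_nonneg_right ?_ hN0.le
    have : 4 * (Real.pi / (N + 1)) ^ 2 / Real.pi ^ 2
        = 2 * (2 / Real.pi ^ 2 * (Real.pi / (N + 1)) ^ 2) := by ring
    linarith
  have hpi2 : Real.pi ^ 2 ≤ 10 := by
    have := Real.pi_lt_d2
    nlinarith
  set W := (m : ℝ) ^ 2 / (N + 1) * (1 + (N + 1) / m + 1 / s) with hW
  have hWeq : W = (m : ℝ) ^ 2 / (N + 1) + m + (m : ℝ) ^ 2 / ((N + 1) * s) := by
    rw [hW]; field_simp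
  have hp1 : 0 < (m : ℝ) ^ 2 / (N + 1) := by positivity
  have hp2 : 0 < (m : ℝ) ^ 2 / ((N + 1) * s) := by positivity
  have hKle : K / (2 * lam) ≤ 40 * W := by
    have hK0 : 0 ≤ K := by rw [hK]; positivity
    calc K / (2 * lam) ≤ K / (4 * (Real.pi / (N + 1)) ^ 2 / Real.pi ^ 2 / N) :=
          div_le_div_of_nonneg_left hK0 (by positivity) hlow
      _ = Real.pi ^ 2 * (2 * m + 4 * ((m : ℝ) ^ 2 / (N + 1) + (m : ℝ) ^ 2 / ((N + 1) * s))) := by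
          rw [hK]
          field_simp
          ring
      _ ≤ 10 * (4 * W) := by
          refine mul_le_mul hpi2 ?_ (by positivity) (by norm_num)
          rw [hWeq]
          linarith
      _ = 40 * W := by ring
  -- `42 = 40 + 2`: the terms other than `K / (2 * lam)` amount to at most `2 * W`.
  linarith

lemma two_mul_lam_mul_le {N : ℕ} {t l lam : ℝ} (hN : 0 < N) (ht : 0 ≤ t)
    (hlam : lam = (1 - Real.cos (Real.pi / (N + 1))) / N)
    (htl : t ≤ ((N : ℝ) + 1) ^ 3 / Real.pi ^ 2 * l) (hl : l ≤ Real.log (N + 1)) :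
    2 * lam * t ≤ l + 1 := by
  have hN0 : (0 : ℝ) < N := by exact_mod_cast hN
  have hpi := Real.pi_pos
  have hup : 2 * lam ≤ (Real.pi / (N + 1)) ^ 2 / N := by
    have h := Real.one_sub_sq_div_two_le_cos (x := Real.pi / (N + 1))
    rw [hlam, mul_div_assoc']
    exact div_le_div_of_nonneg_right (by linarith) hN0.le
  have hlog : Real.log (N + 1) ≤ N := by
    have := Real.log_le_sub_one_of_pos (show (0 : ℝ) < N + 1 by positivity)
    linarith
  calc 2 * lam * t ≤ (Real.pi / (N + 1)) ^ 2 / N * t := mul_le_mul_of_nonneg_right hup ht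
    _ ≤ (Real.pi / (N + 1)) ^ 2 / N * (((N : ℝ) + 1) ^ 3 / Real.pi ^ 2 * l) :=
        mul_le_mul_of_nonneg_left htl (by positivity)
    -- There are `N = n - 1` edges but the claim has `n³`; the mismatch costs the factor `1 + 1/N`,
    -- harmless since `l ≤ log (N + 1) ≤ N`.
    _ = l + l / N := by field_simp
    _ ≤ l + 1 := by
        have : l / N ≤ 1 := (div_le_one hN0).2 (hl.trans hlog)
        linarith

theorem proposition2 (ε : ℝ) (hε : ε ∈ Set.Ioo (0 : ℝ) 1) :
    ∃ C : ℝ, 0 < C ∧ ∀ (n m : ℕ) (s : ℝ), 2 ≤ n → 2 ≤ m → 0 < s →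
      (((n : ℝ) ^ 3 / Real.pi ^ 2 *
          (Real.log n - Real.log (1 + (n : ℝ) / m + 1 / s) - C) : ℝ) : EReal)
        ≤ mixingTimeBB (SimpleGraph.pathGraph n) (fun _ => 1) s m ε := by
  obtain ⟨hε0, hε1⟩ := hε
  have hε' : 0 < 1 - ε := by linarith
  have hC2000 : 2000 ≤ 2000 / (1 - ε) := by
    rw [le_div_iff₀ hε']
    linarith
  -- Any number above `4 * 4 * 42 * 2.72 < 1828` would serve in the final comparison. Being large,
  -- 2000 also forces `N ≥ 3` whenever the claimed bound is positive.
  refine ⟨Real.log (2000 / (1 - ε)), Real.log_pos (by linarith), fun n m s hn hm hs => ?_⟩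
  set C := Real.log (2000 / (1 - ε)) with hC
  have hexpC : Real.exp C = 2000 / (1 - ε) := Real.exp_log (by linarith)
  obtain ⟨N, rfl⟩ : ∃ N, n = N + 1 := ⟨n - 1, by omega⟩
  refine le_sInf ?_
  rintro _ ⟨t, ⟨ht0, ht⟩, rfl⟩
  rw [EReal.coe_le_coe_iff]
  by_contra! hlt
  push_cast at hlt
  have hm' : (0 : ℝ) < m := by exact_mod_cast (by omega : 0 < m)
  set R := 1 + ((N : ℝ) + 1) / m + 1 / s with hR
  have hR1 : 1 ≤ R := by
    have h1 : 0 ≤ ((N : ℝ) + 1) / m := by positivity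
    have h2 : 0 ≤ 1 / s := by positivity
    linarith
  have hlogR : 0 ≤ Real.log R := Real.log_nonneg hR1
  have hC0 : 0 < C := Real.log_pos (by linarith)
  set l := Real.log (N + 1) - Real.log R - C with hl
  have hfac : 0 < ((N : ℝ) + 1) ^ 3 / Real.pi ^ 2 := by
    have := Real.pi_pos
    positivity
  have hl0 : 0 < l := (mul_pos_iff_of_pos_left hfac).1 (ht0.trans_lt hlt)
  have hN : 3 ≤ N := by
    have h1 : C < Real.log (N + 1) := by linarith
    have h2 : 2000 / (1 - ε) < (N : ℝ) + 1 :=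
      (Real.log_lt_log_iff (by linarith) (by positivity)).1 h1
    have h3 : (3 : ℝ) ≤ N := by linarith
    exact_mod_cast h3
  have hexp : R / (N + 1) * Real.exp C ≤ Real.exp 1
      * Real.exp (-(2 * ((1 - Real.cos (Real.pi / (N + 1))) / N)) * t) := by
    have h1 := two_mul_lam_mul_le (by omega) ht0 rfl hlt.le (by linarith)
    have h2 : R / (N + 1) * Real.exp C = Real.exp (-l) := by
      rw [hl, show -(Real.log (N + 1) - Real.log R - C) = Real.log R - Real.log (N + 1) + C by ring,
        Real.exp_add, Real.exp_sub, Real.exp_log (show 0 < R by linarith),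
        Real.exp_log (show (0 : ℝ) < N + 1 by positivity)]
    rw [h2, ← Real.exp_add]
    exact Real.exp_le_exp.2 (by linarith)
  have hmain := le_of_tvDist_le hN (by omega) hs ht0 ht rfl rfl
  have hnoise := noise_le (s := s) hN (show 0 < m by omega) hs rfl rfl
  rw [← hR] at hnoise
  set E := Real.exp (-(2 * ((1 - Real.cos (Real.pi / (N + 1))) / N)) * t)
  have hE : 0 < E := Real.exp_pos _
  rw [sub_le_comm, le_div_iff₀ (by positivity)] at hmain
  have he := Real.exp_one_lt_d9
  have hW : 0 < (m : ℝ) ^ 2 / (N + 1) * R := by positivity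
  have hsignal : (m : ℝ) ^ 2 / (N + 1) * R * 2000 ≤ (1 - ε) * ((m : ℝ) ^ 2 * (2.72 * E)) := by
    have h1 : R / (N + 1) * (2000 / (1 - ε)) ≤ 2.72 * E := by
      rw [← hexpC]
      exact hexp.trans (mul_le_mul_of_nonneg_right (by linarith) hE.le)
    calc _ = (1 - ε) * ((m : ℝ) ^ 2 * (R / (N + 1) * (2000 / (1 - ε)))) := by field_simp
      _ ≤ _ := by gcongr
  -- `hmain` and `hnoise` give `(1 - ε) * m² * E ≤ 672 * W`, whereas `hsignal` gives `2000 * W ≤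
  -- 2.72 * (1 - ε) * m² * E`; this is impossible for `W > 0`.
  nlinarith
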